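/- Let $n\ge 0$ agents have valuations drawn i.i.d. from a distribution with support $[a,b]$, $0\le a<b<\infty$, with cumulative distribution function $F$ and a (measurable) density $f$ that is positive on $[a,b]$. Let $\mathcal X\subseteq\{0,1\}^n$ be an arbitrary set of feasible allocation vectors. A (direct, possibly randomized) mechanism maps a valuation profile $\mathbf v$, together with an independent random seed $\omega$ from a fixed probability space (a one-point space for deterministic mechanisms), to an allocation $\mathbf x(\mathbf v,\omega)\in\mathcal X$ and burnt payments $\mathbf p(\mathbf v,\omega)\in[0,\infty)^n$. Write $x_i(v)$ and $p_i(v)$ for the expected allocation and the expected payment (assumed finite) of agent $i$ when it reports $v$ and the others report truthfully. Mechanisms are required to be Bayesian incentive compatible, $v\,x_i(v)-p_i(v)\ge v\,x_i(v')-p_i(v')$ for all $i$ and $v,v'\in[a,b]$; interim individually rational, $v\,x_i(v)-p_i(v)\ge 0$ for all $i$ and $v\in[a,b]$; and normalized so that the lowest type has utility $a\,x_i(a)-p_i(a)=0$ for all $i$ (this is automatic when $a=0$). Let $\vartheta(z)=\frac{1-F(z)}{f(z)}$, $h(q)=\vartheta(F^{-1}(q))$ and $H(q)=\int_0^q h(r)\,dr$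 for $q\in[0,1]$, let $G$ be the largest convex function on $[0,1]$ with $G\le H$, let $g$ be the derivative of $G$, extended to $[0,1)$ by right-continuity and to $1$ by the left derivative, and let $\bar\vartheta(z)=g(F(z))$. Then a mechanism maximizes the expected residual surplus $\mathbf E\big[\sum_i (v_i x_i(\mathbf v,\omega)-p_i(\mathbf v,\omega))\big]$ among all such mechanisms if and only if 1. for almost every $(\mathbf v,\omega)$, $\mathbf x(\mathbf v,\omega)\in\operatorname{argmax}_{\mathbf x'\in\mathcal X}\sum_i\bar\vartheta(v_i)\,x'_i$; and 2. for all $i$ and all $v\in[a,b]$ with $G(F(v))<H(F(v))$, the derivative $\frac{d}{dv}x_i(v)$ exists and equals $0$. -/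

import Mathlib

open MeasureTheory

noncomputable section

namespace MoneyBurning

/-! ### Ironing

`μ` is the valuation distribution, with cumulative distribution function `ProbabilityTheory.cdf μ`
and density `f` on the support `[a, b]`. -/

/-- Virtual valuation for utility `ϑ(z) = (1 - F(z)) / f(z)`. -/
def virtualVal (μ : Measure ℝ) (f : ℝ → ℝ) (z : ℝ) : ℝ :=
  (1 - ProbabilityTheory.cdf μ z) / f z

/-- The inverse `F⁻¹ : [0, 1] → [a, b]` of the distribution function on the support. -/
def cdfInv (μ : Measure ℝ) (a b : ℝ) (q : ℝ) : ℝ :=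
  Function.invFunOn (ProbabilityTheory.cdf μ) (Set.Icc a b) q

/-- `h(q) = ϑ(F⁻¹(q))`. -/
def hFun (μ : Measure ℝ) (f : ℝ → ℝ) (a b : ℝ) (q : ℝ) : ℝ :=
  virtualVal μ f (cdfInv μ a b q)

/-- `H(q) = ∫₀^q h(r) dr`. -/
def HFun (μ : Measure ℝ) (f : ℝ → ℝ) (a b : ℝ) (q : ℝ) : ℝ :=
  ∫ r in (0 : ℝ)..q, hFun μ f a b r

/-- The convex hull on `[0, 1]` of a function `H`: the pointwise largest convex function on `[0, 1]`
that is bounded above by `H` there (only its values on `[0, 1]` are meaningful). -/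
def convexHullFun (H : ℝ → ℝ) (q : ℝ) : ℝ :=
  sSup {y : ℝ | ∃ φ : ℝ → ℝ,
    ConvexOn ℝ (Set.Icc 0 1) φ ∧ (∀ r ∈ Set.Icc (0 : ℝ) 1, φ r ≤ H r) ∧ y = φ q}

/-- `G`, the convex hull of `H`. -/
def GFun (μ : Measure ℝ) (f : ℝ → ℝ) (a b : ℝ) : ℝ → ℝ :=
  convexHullFun (HFun μ f a b)

/-- `g`, the derivative of `G` extended by right-continuity. For a convex function this is the right
derivative; at the endpoint `q = 1` of the domain it is the left derivative. -/
def gFun (μ : Measure ℝ) (f : ℝ → ℝ) (a b : ℝ) (q : ℝ) : ℝ :=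
  if q < 1 then derivWithin (GFun μ f a b) (Set.Ioi q) q
  else derivWithin (GFun μ f a b) (Set.Iio q) q

/-- The ironed virtual valuation for utility `z ↦ g(F(z))`. -/
def ironedVal (μ : Measure ℝ) (f : ℝ → ℝ) (a b : ℝ) (z : ℝ) : ℝ :=
  gFun μ f a b (ProbabilityTheory.cdf μ z)

/-! ### Mechanisms -/

/-- A direct, possibly randomized, mechanism for `n` agents: from the reported valuation profile `v`
and the random seed `ω` it computes an allocation vector and a vector of (burnt) payments.
Deterministic mechanisms are those with a one-point seed space. -/
structure Mechanism (n : ℕ) (Ω : Type*) where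
  alloc : (Fin n → ℝ) → Ω → Fin n → ℝ
  pay : (Fin n → ℝ) → Ω → Fin n → ℝ

namespace Mechanism

variable {n : ℕ} {Ω : Type*} [MeasurableSpace Ω]

/-- The joint law of an i.i.d. valuation profile and of the independent seed. -/
def jointLaw (n : ℕ) (μ : Measure ℝ) (P : Measure Ω) : Measure ((Fin n → ℝ) × Ω) :=
  (Measure.pi fun _ : Fin n => μ).prod P

/-- Interim allocation `x_i(z)`: the probability that agent `i` is served when its valuation is `z`
(the `i`-th coordinate of the random profile is overwritten by `z`). -/
def interimAlloc (M : Mechanism n Ω) (μ : Measure ℝ) (P : Measure Ω) (i : Fin n) (z : ℝ) : ℝ :=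
  ∫ q, M.alloc (Function.update q.1 i z) q.2 i ∂(jointLaw n μ P)

/-- Interim payment `p_i(z)`. -/
def interimPay (M : Mechanism n Ω) (μ : Measure ℝ) (P : Measure Ω) (i : Fin n) (z : ℝ) : ℝ :=
  ∫ q, M.pay (Function.update q.1 i z) q.2 i ∂(jointLaw n μ P)

/-- Interim utility of agent `i` with valuation `z` who reports `z'`. -/
def interimUtil (M : Mechanism n Ω) (μ : Measure ℝ) (P : Measure Ω) (i : Fin n) (z z' : ℝ) : ℝ :=
  z * M.interimAlloc μ P i z' - M.interimPay μ P i z'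

/-- Expected residual surplus `E[∑ᵢ (vᵢ xᵢ(v) - pᵢ(v))]`. -/
def residualSurplus (M : Mechanism n Ω) (μ : Measure ℝ) (P : Measure Ω) : ℝ :=
  ∫ q, ∑ i, (q.1 i * M.alloc q.1 q.2 i - M.pay q.1 q.2 i) ∂(jointLaw n μ P)

/-- The Bayesian incentive compatible mechanisms for the type space `[a, b]` and the set `X` of
feasible allocation vectors. -/
structure IsAdmissible (M : Mechanism n Ω) (μ : Measure ℝ) (P : Measure Ω) (a b : ℝ)
    (X : Set (Fin n → ℝ)) : Prop where
  measurable_alloc : ∀ i, Measurable fun q : (Fin n → ℝ) × Ω => M.alloc q.1 q.2 i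
  measurable_pay : ∀ i, Measurable fun q : (Fin n → ℝ) × Ω => M.pay q.1 q.2 i
  /-- The chosen allocation is always feasible. -/
  feasible : ∀ v ω, M.alloc v ω ∈ X
  /-- No positive transfers to the agents. -/
  pay_nonneg : ∀ v ω i, 0 ≤ M.pay v ω i
  /-- Every type has a finite interim payment. -/
  integrable_pay : ∀ i, ∀ z ∈ Set.Icc a b,
    Integrable (fun q : (Fin n → ℝ) × Ω => M.pay (Function.update q.1 i z) q.2 i) (jointLaw n μ P)
  /-- Truthtelling is a Bayes-Nash equilibrium. -/
  incentive_compatible : ∀ i, ∀ z ∈ Set.Icc a b, ∀ z' ∈ Set.Icc a b,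
    M.interimUtil μ P i z z' ≤ M.interimUtil μ P i z z
  /-- Interim individual rationality. -/
  individually_rational : ∀ i, ∀ z ∈ Set.Icc a b, 0 ≤ M.interimUtil μ P i z z
  /-- The usual normalization of payments: the lowest type has interim utility zero. When `a = 0`
  this is implied by the other conditions, see `interimUtil_zero`. -/
  lowest_type : ∀ i, M.interimUtil μ P i a a = 0

/-- For `a = 0` the normalization of the lowest type is no restriction: it follows from
nonnegativity of the payments and individual rationality. -/
theorem interimUtil_zero (M : Mechanism n Ω) (μ : Measure ℝ) (P : Measure Ω)
    (hpay : ∀ v ω i, 0 ≤ M.pay v ω i) (i : Fin n) (hir : 0 ≤ M.interimUtil μ P i 0 0) :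
    M.interimUtil μ P i 0 0 = 0 := by
  have h : 0 ≤ M.interimPay μ P i 0 := integral_nonneg fun q => hpay _ _ _
  unfold interimUtil at *
  linarith

/-- `M` maximizes the expected residual surplus among all admissible mechanisms. -/
def IsOptimal (M : Mechanism n Ω) (μ : Measure ℝ) (P : Measure Ω) (a b : ℝ)
    (X : Set (Fin n → ℝ)) : Prop :=
  M.IsAdmissible μ P a b X ∧
    ∀ M' : Mechanism n Ω, M'.IsAdmissible μ P a b X →
      M'.residualSurplus μ P ≤ M.residualSurplus μ P

end Mechanism

end MoneyBurning

end

/-!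
Incentive compatibility makes the interim allocation a subgradient of the interim utility, so by the
envelope formula the residual surplus of an admissible mechanism is its expected virtual surplus
`E[∑ᵢ ϑ(vᵢ) xᵢ(v)]`. Replacing `ϑ` by the ironed `ϑ̄` changes the contribution of agent `i` by the
integral over the levels `s` of the gap `H - G` at the quantile where its monotone interim
allocation passes `s`. This loss is nonnegative, and it vanishes exactly when the interim allocation
is locally constant where `G < H`. Hence the ironed surplus minus the losses is maximal when both
parts are, provided that they can be optimized simultaneously: maximizing the ironed surplus
pointwise, with ties broken by the ironed values alone, gives an allocation rule that is monotone,
so that envelope payments implement it, and that ignores reports within an ironed interval.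
-/

noncomputable section

namespace MoneyBurning

open Set Filter Topology ProbabilityTheory

/-! ### The convex hull of a function on `[0, 1]` -/

section ConvexHull

variable {H φ : ℝ → ℝ} {q : ℝ}

/-- `φ` is convex and lies below `H` on `[0, 1]`. The convex hull of `H` is the supremum of its
convex minorants. -/
def IsConvexMinorant (H φ : ℝ → ℝ) : Prop :=
  ConvexOn ℝ (Icc 0 1) φ ∧ ∀ r ∈ Icc (0 : ℝ) 1, φ r ≤ H r

theorem IsConvexMinorant.le_convexHullFun (hφ : IsConvexMinorant H φ) (hq : q ∈ Icc (0 : ℝ) 1) :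
    φ q ≤ convexHullFun H q := by
  refine le_csSup ⟨H q, ?_⟩ ⟨φ, hφ.1, hφ.2, rfl⟩
  rintro y ⟨ψ, -, hψ, rfl⟩
  exact hψ q hq

theorem IsConvexMinorant.convexHullFun (hφ : IsConvexMinorant H φ) :
    IsConvexMinorant H (convexHullFun H) := by
  refine ⟨⟨convex_Icc 0 1, fun x hx y hy s t hs ht hst => ?_⟩, fun r hr => ?_⟩
  · refine csSup_le ⟨_, φ, hφ.1, hφ.2, rfl⟩ ?_
    rintro z ⟨ψ, hψ, hle, rfl⟩
    refine (hψ.2 hx hy hs ht hst).trans ?_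
    simp only [smul_eq_mul]
    gcongr
    · exact le_convexHullFun ⟨hψ, hle⟩ hx
    · exact le_convexHullFun ⟨hψ, hle⟩ hy
  · refine csSup_le ⟨_, φ, hφ.1, hφ.2, rfl⟩ ?_
    rintro y ⟨ψ, -, hψ, rfl⟩
    exact hψ r hr

theorem convexOn_affine {s : Set ℝ} (hs : Convex ℝ s) (k c : ℝ) :
    ConvexOn ℝ s fun r => k * r + c :=
  ((LinearMap.mul ℝ ℝ k).convexOn hs).add_const c

theorem exists_sub_mul_abs_le {s : Set ℝ} (hs : IsCompact s) (hc : ContinuousOn H s) {e : ℝ}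
    (he : e ∈ s) {ε : ℝ} (hε : 0 < ε) : ∃ K : ℝ, ∀ r ∈ s, H e - ε - K * |r - e| ≤ H r := by
  obtain ⟨m, hm⟩ := (hs.image_of_continuousOn hc).bddBelow
  obtain ⟨δ, hδ, hnear⟩ := Metric.continuousWithinAt_iff.1 (hc e he) ε hε
  simp only [Real.dist_eq] at hnear
  refine ⟨|H e - m| / δ, fun r hr => ?_⟩
  rcases lt_or_ge |r - e| δ with hlt | hge
  · have h1 := (abs_lt.1 (hnear hr hlt)).1
    have h2 : 0 ≤ |H e - m| / δ * |r - e| := by positivity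
    linarith
  · have h1 : |H e - m| ≤ |H e - m| / δ * |r - e| := by
      rw [div_mul_eq_mul_div, le_div_iff₀ hδ]; gcongr
    linarith [hm (mem_image_of_mem H hr), le_abs_self (H e - m)]

theorem exists_isConvexMinorant_affine (hc : ContinuousOn H (Icc 0 1)) {e : ℝ}
    (he : e = 0 ∨ e = 1) {ε : ℝ} (hε : 0 < ε) :
    ∃ k c : ℝ, k * e + c = H e - ε ∧ IsConvexMinorant H fun r => k * r + c := by
  obtain ⟨K, hK⟩ := exists_sub_mul_abs_le isCompact_Icc hc
    (show e ∈ Icc (0 : ℝ) 1 by rcases he with rfl | rfl <;> simp) hε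
  obtain ⟨k, hk⟩ : ∃ k : ℝ, ∀ r ∈ Icc (0 : ℝ) 1, k * (r - e) = -(K * |r - e|) := by
    rcases he with rfl | rfl
    · exact ⟨-K, fun r hr => by rw [sub_zero, abs_of_nonneg hr.1, neg_mul]⟩
    · exact ⟨K, fun r hr => by rw [abs_of_nonpos (sub_nonpos.2 hr.2)]; ring⟩
  exact ⟨k, H e - ε - k * e, by ring, convexOn_affine (convex_Icc 0 1) _ _,
    fun r hr => by linarith [hK r hr, hk r hr]⟩

theorem isConvexMinorant_convexHullFun (hc : ContinuousOn H (Icc 0 1)) :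
    IsConvexMinorant H (convexHullFun H) :=
  let ⟨_, _, _, h⟩ := exists_isConvexMinorant_affine hc (.inl rfl) one_pos
  h.convexHullFun

theorem convexOn_convexHullFun (hc : ContinuousOn H (Icc 0 1)) :
    ConvexOn ℝ (Icc 0 1) (convexHullFun H) :=
  (isConvexMinorant_convexHullFun hc).1

theorem convexHullFun_le (hc : ContinuousOn H (Icc 0 1)) (hq : q ∈ Icc (0 : ℝ) 1) :
    convexHullFun H q ≤ H q :=
  (isConvexMinorant_convexHullFun hc).2 q hq

theorem tendsto_convexHullFun_endpoint (hc : ContinuousOn H (Icc 0 1)) {e : ℝ}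
    (he : e = 0 ∨ e = 1) : Tendsto (convexHullFun H) (𝓝[Icc 0 1] e) (𝓝 (H e)) := by
  have he01 : e ∈ Icc (0 : ℝ) 1 := by rcases he with rfl | rfl <;> simp
  refine tendsto_order.2 ⟨fun y hy => ?_, fun y hy => ?_⟩
  · obtain ⟨k, c, hkc, hminor⟩ := exists_isConvexMinorant_affine hc he (half_pos (sub_pos.2 hy))
    have hlim : Tendsto (fun r => k * r + c) (𝓝[Icc 0 1] e) (𝓝 (k * e + c)) :=
      Continuous.continuousWithinAt (by fun_prop)
    filter_upwards [self_mem_nhdsWithin, hlim.eventually_const_lt (show y < k * e + c by linarith)]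
      with r hr hlt using hlt.trans_le (hminor.le_convexHullFun hr)
  · filter_upwards [self_mem_nhdsWithin, (hc e he01).eventually_lt_const hy]
      with r hr hlt using (convexHullFun_le hc hr).trans_lt hlt

theorem convexHullFun_endpoint (hc : ContinuousOn H (Icc 0 1)) {e : ℝ} (he : e = 0 ∨ e = 1) :
    convexHullFun H e = H e :=
  tendsto_nhds_unique (tendsto_pure_nhds _ e) <|
    (tendsto_convexHullFun_endpoint hc he).mono_left <| pure_le_nhdsWithin <| by
      rcases he with rfl | rfl <;> simp

theorem continuousOn_convexHullFun (hc : ContinuousOn H (Icc 0 1)) :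
    ContinuousOn (convexHullFun H) (Icc 0 1) := by
  intro q hq
  by_cases he : q = 0 ∨ q = 1
  · rw [ContinuousWithinAt, convexHullFun_endpoint hc he]
    exact tendsto_convexHullFun_endpoint hc he
  · have hq' : q ∈ interior (Icc (0 : ℝ) 1) := by
      rw [interior_Icc]
      push Not at he
      exact ⟨hq.1.lt_of_ne' he.1, hq.2.lt_of_ne he.2⟩
    exact ((convexOn_convexHullFun hc).continuousOn_interior.continuousAt
      (isOpen_interior.mem_nhds hq')).continuousWithinAt

theorem mem_Ioo_of_convexHullFun_lt (hc : ContinuousOn H (Icc 0 1)) (hq : q ∈ Icc (0 : ℝ) 1)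
    (hlt : convexHullFun H q < H q) : q ∈ Ioo (0 : ℝ) 1 := by
  have hne : ∀ e : ℝ, e = 0 ∨ e = 1 → q ≠ e := by
    rintro e he rfl
    exact hlt.ne (convexHullFun_endpoint hc he)
  exact ⟨hq.1.lt_of_ne' (hne 0 (.inl rfl)), hq.2.lt_of_ne (hne 1 (.inr rfl))⟩

theorem convexOn_le_chord {G : ℝ → ℝ} {s : Set ℝ} (hG : ConvexOn ℝ s G) {p t k c : ℝ} (hp : p ∈ s)
    (ht : t ∈ s) (hpt : p < t) (hkp : k * p + c = G p) (hkt : k * t + c = G t) {r : ℝ}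
    (hr : r ∈ Icc p t) : G r ≤ k * r + c := by
  rcases eq_or_lt_of_le hr.1 with rfl | hpr
  · exact hkp.ge
  rcases eq_or_lt_of_le hr.2 with rfl | hrt
  · exact hkt.ge
  have h := hG.secant_mono_aux1 hp ht hpr hrt
  refine le_of_mul_le_mul_left (h.trans_eq ?_) (sub_pos.2 hpt)
  rw [← hkp, ← hkt]; ring

theorem chord_le_convexOn {G : ℝ → ℝ} {s : Set ℝ} (hG : ConvexOn ℝ s G) {p t k c : ℝ} (hp : p ∈ s)
    (ht : t ∈ s) (hpt : p < t) (hkp : k * p + c = G p) (hkt : k * t + c = G t) {r : ℝ}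
    (hr : r ∈ s) (hr' : r ∉ Icc p t) : k * r + c ≤ G r := by
  rcases lt_or_ge r p with hrp | hpr
  · have h := hG.secant_mono_aux1 hr ht hrp hpt
    refine le_of_mul_le_mul_left (le_trans (le_of_eq ?_) (sub_le_iff_le_add.2 h)) (sub_pos.2 hpt)
    rw [← hkp, ← hkt]; ring
  · have htr : t < r := not_le.1 fun h => hr' ⟨hpr, h⟩
    have h := hG.secant_mono_aux1 hp hr hpt htr
    refine le_of_mul_le_mul_left (le_trans (le_of_eq ?_) (sub_le_iff_le_add'.2 h)) (sub_pos.2 hpt)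
    rw [← hkp, ← hkt]; ring

theorem convexHullFun_eq_chord (hc : ContinuousOn H (Icc 0 1)) {p t k c : ℝ}
    (hp : p ∈ Icc (0 : ℝ) 1) (ht : t ∈ Icc (0 : ℝ) 1) (hpt : p < t)
    (hkp : k * p + c = convexHullFun H p) (hkt : k * t + c = convexHullFun H t)
    (hle : ∀ r ∈ Icc p t, k * r + c ≤ H r) {r : ℝ} (hr : r ∈ Icc p t) :
    convexHullFun H r = k * r + c := by
  have hG := convexOn_convexHullFun hc
  have hsup : IsConvexMinorant H fun r => max (convexHullFun H r) (k * r + c) := by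
    refine ⟨hG.sup (convexOn_affine (convex_Icc 0 1) k c), fun r hr =>
      max_le (convexHullFun_le hc hr) ?_⟩
    by_cases hmem : r ∈ Icc p t
    · exact hle r hmem
    · exact (chord_le_convexOn hG hp ht hpt hkp hkt hr hmem).trans (convexHullFun_le hc hr)
  exact le_antisymm (convexOn_le_chord hG hp ht hpt hkp hkt hr)
    ((le_max_right _ _).trans (hsup.le_convexHullFun (Icc_subset_Icc hp.1 ht.2 hr)))

theorem convexHullFun_eventuallyEq_affine (hc : ContinuousOn H (Icc 0 1))
    (hq : q ∈ Icc (0 : ℝ) 1) (hlt : convexHullFun H q < H q) :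
    ∃ k c : ℝ, convexHullFun H =ᶠ[𝓝 q] fun r => k * r + c := by
  have hq' := mem_Ioo_of_convexHullFun_lt hc hq hlt
  have hn : Icc (0 : ℝ) 1 ∈ 𝓝 q := Icc_mem_nhds hq'.1 hq'.2
  obtain ⟨m, hGm, hmH⟩ := exists_between hlt
  -- On a small `[p, t]` around `q` the hull stays below the level `m` and `H` above it.
  have hsep : ∀ᶠ r in 𝓝 q, convexHullFun H r < m ∧ m < H r ∧ r ∈ Icc (0 : ℝ) 1 :=
    (((continuousOn_convexHullFun hc).continuousAt hn).eventually_lt_const hGm).and <|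
      ((hc.continuousAt hn).eventually_const_lt hmH).and hn
  obtain ⟨δ, hδ, hball⟩ := Metric.nhds_basis_closedBall.eventually_iff.1 hsep
  simp only [Real.closedBall_eq_Icc] at hball
  set p := q - δ
  set t := q + δ
  have hpt : p < t := by simp only [p, t]; linarith
  obtain ⟨hpm, -, hp⟩ := hball (left_mem_Icc.2 hpt.le)
  obtain ⟨htm, -, ht⟩ := hball (right_mem_Icc.2 hpt.le)
  obtain ⟨k, c, hkp, hkt⟩ : ∃ k c : ℝ,
      k * p + c = convexHullFun H p ∧ k * t + c = convexHullFun H t := by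
    have hne : t - p ≠ 0 := (sub_pos.2 hpt).ne'
    refine ⟨(convexHullFun H t - convexHullFun H p) / (t - p),
      convexHullFun H p - (convexHullFun H t - convexHullFun H p) / (t - p) * p, ?_, ?_⟩ <;>
    field_simp <;> ring
  have hchord : ∀ r ∈ Icc p t, k * r + c ≤ H r := fun r hr =>
    (((convexOn_affine (convex_Icc p t) k c).le_max_of_mem_Icc (left_mem_Icc.2 hpt.le)
      (right_mem_Icc.2 hpt.le) hr).trans
        (max_le (hkp.trans_lt hpm).le (hkt.trans_lt htm).le)).trans (hball hr).2.1.le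
  refine ⟨k, c, ?_⟩
  filter_upwards [Icc_mem_nhds (show p < q by simp [p, hδ]) (show q < t by simp [t, hδ])] with r hr
    using convexHullFun_eq_chord hc hp ht hpt hkp hkt hchord hr

end ConvexHull

/-! ### The valuation distribution -/

/-- `μ` is supported on `[a, b]` with a density `f` that is positive there. -/
structure IsValuationLaw (μ : Measure ℝ) (f : ℝ → ℝ) (a b : ℝ) : Prop where
  lt : a < b
  measurable_density : Measurable f
  density_pos : ∀ z ∈ Icc a b, 0 < f z
  eq_withDensity : μ = (volume.restrict (Icc a b)).withDensity fun z => ENNReal.ofReal (f z)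

theorem cdf_mem_Icc (μ : Measure ℝ) (z : ℝ) : cdf μ z ∈ Icc (0 : ℝ) 1 :=
  ⟨cdf_nonneg μ z, cdf_le_one μ z⟩

theorem measurable_gFun (μ : Measure ℝ) (f : ℝ → ℝ) (a b : ℝ) : Measurable (gFun μ f a b) := by
  have hleft : Measurable fun q => derivWithin (GFun μ f a b) (Iio q) q := by
    have hneg : (fun q => derivWithin (GFun μ f a b) (Iio q) q) =
        fun q => -derivWithin (fun r => GFun μ f a b (-r)) (Ioi (-q)) (-q) := by
      funext q
      rw [derivWithin_comp_neg, neg_neg, neg_neg, neg_Ioi, neg_neg]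
    rw [hneg]
    exact ((measurable_derivWithin_Ioi _).comp measurable_neg).neg
  exact (measurable_derivWithin_Ioi _).ite measurableSet_Iio hleft

theorem measurable_ironedVal (μ : Measure ℝ) (f : ℝ → ℝ) (a b : ℝ) :
    Measurable (ironedVal μ f a b) :=
  (measurable_gFun μ f a b).comp (monotone_cdf μ).measurable

namespace IsValuationLaw

variable {μ : Measure ℝ} {f : ℝ → ℝ} {a b : ℝ}

theorem absolutelyContinuous (h : IsValuationLaw μ f a b) : μ ≪ volume.restrict (Icc a b) := by
  rw [h.eq_withDensity]
  exact withDensity_absolutelyContinuous _ _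

theorem measure_singleton (h : IsValuationLaw μ f a b) (z : ℝ) : μ {z} = 0 :=
  h.absolutelyContinuous (by simp)

theorem ae_mem_Ioo (h : IsValuationLaw μ f a b) : ∀ᵐ z ∂μ, z ∈ Ioo a b := by
  refine h.absolutelyContinuous.ae_le ?_
  rw [← restrict_Ioo_eq_restrict_Icc]
  exact ae_restrict_mem measurableSet_Ioo

theorem ae_mem_Icc (h : IsValuationLaw μ f a b) : ∀ᵐ z ∂μ, z ∈ Icc a b :=
  h.ae_mem_Ioo.mono fun _ hz => Ioo_subset_Icc_self hz

theorem integrable_iff (h : IsValuationLaw μ f a b) (φ : ℝ → ℝ) :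
    Integrable φ μ ↔ IntegrableOn (fun z => f z * φ z) (Icc a b) := by
  have hiff := integrable_withDensity_iff_integrable_smul' (μ := volume.restrict (Icc a b))
    (g := φ) h.measurable_density.ennreal_ofReal (by simp)
  rw [← h.eq_withDensity] at hiff
  rw [hiff]
  refine integrable_congr ?_
  filter_upwards [ae_restrict_mem measurableSet_Icc] with z hz
  simp only [ENNReal.toReal_ofReal (h.density_pos z hz).le, smul_eq_mul]

theorem measurable_virtualVal (h : IsValuationLaw μ f a b) : Measurable (virtualVal μ f) :=
  (measurable_const.sub (monotone_cdf μ).measurable).div h.measurable_density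

theorem density_mul_virtualVal (h : IsValuationLaw μ f a b) {z : ℝ} (hz : z ∈ Icc a b) :
    f z * virtualVal μ f z = 1 - cdf μ z :=
  mul_div_cancel₀ _ (h.density_pos z hz).ne'

theorem virtualVal_nonneg (h : IsValuationLaw μ f a b) {z : ℝ} (hz : z ∈ Icc a b) :
    0 ≤ virtualVal μ f z :=
  div_nonneg (sub_nonneg.2 (cdf_le_one μ z)) (h.density_pos z hz).le

variable [IsProbabilityMeasure μ]

theorem continuous_cdf (h : IsValuationLaw μ f a b) : Continuous (cdf μ) := by
  refine continuous_iff_continuousAt.2 fun z => ?_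
  rw [(monotone_cdf μ).continuousAt_iff_leftLim_eq_rightLim, StieltjesFunction.rightLim_eq]
  have hjump := (cdf μ).measure_singleton z
  rw [measure_cdf, h.measure_singleton, eq_comm, ENNReal.ofReal_eq_zero] at hjump
  exact le_antisymm ((monotone_cdf μ).leftLim_le le_rfl) (by linarith)

theorem cdf_left (h : IsValuationLaw μ f a b) : cdf μ a = 0 := by
  have hnull : μ (Iic a) = 0 :=
    measure_eq_zero_iff_ae_notMem.2 (h.ae_mem_Ioo.mono fun _ hz => not_le.2 hz.1)
  rw [cdf_eq_real, measureReal_def, hnull, ENNReal.toReal_zero]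

theorem cdf_right (h : IsValuationLaw μ f a b) : cdf μ b = 1 := by
  have hfull : μ (Iic b) = 1 :=
    (mem_ae_iff_prob_eq_one measurableSet_Iic).1 (h.ae_mem_Ioo.mono fun _ hz => hz.2.le)
  rw [cdf_eq_real, measureReal_def, hfull, ENNReal.toReal_one]

theorem strictMonoOn_cdf (h : IsValuationLaw μ f a b) : StrictMonoOn (cdf μ) (Icc a b) := by
  intro x hx y hy hxy
  refine lt_of_le_of_ne (monotone_cdf μ hxy.le) fun heq => ?_
  have hsub : Ioc x y ⊆ Icc a b := Ioc_subset_Icc_self.trans (Icc_subset_Icc hx.1 hy.2)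
  have hnull : μ (Ioc x y) = 0 := by
    have hIoc := (cdf μ).measure_Ioc x y
    rwa [measure_cdf, heq, sub_self, ENNReal.ofReal_zero] at hIoc
  rw [h.eq_withDensity, withDensity_apply_eq_zero h.measurable_density.ennreal_ofReal] at hnull
  have hvol : volume.restrict (Icc a b) (Ioc x y) = 0 := measure_mono_null
    (show Ioc x y ⊆ {z | ENNReal.ofReal (f z) ≠ 0} ∩ Ioc x y from fun z hz =>
      ⟨(ENNReal.ofReal_pos.2 (h.density_pos z (hsub hz))).ne', hz⟩) hnull
  rw [Measure.restrict_apply measurableSet_Ioc, inter_eq_self_of_subset_left hsub, Real.volume_Ioc,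
    ENNReal.ofReal_eq_zero] at hvol
  linarith

theorem exists_cdf_eq (h : IsValuationLaw μ f a b) {q : ℝ} (hq : q ∈ Icc (0 : ℝ) 1) :
    ∃ z ∈ Icc a b, cdf μ z = q := by
  rw [← h.cdf_left, ← h.cdf_right] at hq
  exact intermediate_value_Icc h.lt.le h.continuous_cdf.continuousOn hq

theorem cdfInv_mem (h : IsValuationLaw μ f a b) {q : ℝ} (hq : q ∈ Icc (0 : ℝ) 1) :
    cdfInv μ a b q ∈ Icc a b :=
  Function.invFunOn_mem (h.exists_cdf_eq hq)

theorem cdf_cdfInv (h : IsValuationLaw μ f a b) {q : ℝ} (hq : q ∈ Icc (0 : ℝ) 1) :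
    cdf μ (cdfInv μ a b q) = q :=
  Function.invFunOn_eq (h.exists_cdf_eq hq)

theorem cdfInv_cdf (h : IsValuationLaw μ f a b) {z : ℝ} (hz : z ∈ Icc a b) :
    cdfInv μ a b (cdf μ z) = z :=
  h.strictMonoOn_cdf.injOn (h.cdfInv_mem (cdf_mem_Icc μ z)) hz (h.cdf_cdfInv (cdf_mem_Icc μ z))

theorem monotoneOn_cdfInv (h : IsValuationLaw μ f a b) : MonotoneOn (cdfInv μ a b) (Icc 0 1) := by
  intro q hq r hr hqr
  rwa [← h.strictMonoOn_cdf.le_iff_le (h.cdfInv_mem hq) (h.cdfInv_mem hr), h.cdf_cdfInv hq,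
    h.cdf_cdfInv hr]

theorem cdf_mem_Ioo_iff (h : IsValuationLaw μ f a b) {z : ℝ} :
    cdf μ z ∈ Ioo (0 : ℝ) 1 ↔ z ∈ Ioo a b := by
  refine ⟨fun hz => ⟨?_, ?_⟩, fun hz => ⟨?_, ?_⟩⟩
  · exact (monotone_cdf μ).reflect_lt (h.cdf_left ▸ hz.1)
  · exact (monotone_cdf μ).reflect_lt (h.cdf_right ▸ hz.2)
  · exact h.cdf_left ▸
      h.strictMonoOn_cdf (left_mem_Icc.2 h.lt.le) (Ioo_subset_Icc_self hz) hz.1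
  · exact h.cdf_right ▸
      h.strictMonoOn_cdf (Ioo_subset_Icc_self hz) (right_mem_Icc.2 h.lt.le) hz.2

theorem map_cdf (h : IsValuationLaw μ f a b) : μ.map (cdf μ) = volume.restrict (Icc 0 1) := by
  have : IsProbabilityMeasure (μ.map (cdf μ)) :=
    Measure.isProbabilityMeasure_map (monotone_cdf μ).measurable.aemeasurable
  refine Measure.ext_of_Iic _ _ fun q => ?_
  obtain ⟨z, hz, hzq⟩ := h.exists_cdf_eq
    (show max 0 (min 1 q) ∈ Icc (0 : ℝ) 1 from ⟨le_max_left _ _, max_le zero_le_one (by simp)⟩)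
  have hpre : cdf μ ⁻¹' Iic q =ᵐ[μ] Iic z := by
    filter_upwards [h.ae_mem_Ioo] with y hy
    have hy' := h.cdf_mem_Ioo_iff.2 hy
    have hclamp : cdf μ y ≤ q ↔ cdf μ y ≤ max 0 (min 1 q) := by
      simp only [le_max_iff, le_min_iff, hy'.1.not_ge, hy'.2.le, true_and, false_or]
    exact propext <| hclamp.trans <| hzq ▸
      h.strictMonoOn_cdf.le_iff_le (Ioo_subset_Icc_self hy) hz
  have hinter : Iic q ∩ Icc (0 : ℝ) 1 = Icc 0 (min 1 q) := by
    rw [inter_comm, ← Ici_inter_Iic, inter_assoc, Iic_inter_Iic, Ici_inter_Iic]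
  rw [Measure.map_apply (monotone_cdf μ).measurable measurableSet_Iic,
    Measure.restrict_apply measurableSet_Iic, hinter, Real.volume_Icc,
    measure_congr hpre, ← ofReal_cdf, hzq, sub_zero, ENNReal.ofReal_max, ENNReal.ofReal_zero,
    max_eq_right zero_le]

theorem setIntegral_Ioi_comp_cdf (h : IsValuationLaw μ f a b) {φ : ℝ → ℝ}
    (hφ : AEStronglyMeasurable φ (volume.restrict (Icc 0 1))) {c : ℝ} (hc : c ∈ Icc a b) :
    ∫ z in Ioi c, φ (cdf μ z) ∂μ = ∫ q in (cdf μ c)..1, φ q := by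
  have hpre : (Ioi c : Set ℝ) =ᵐ[μ] cdf μ ⁻¹' Ioi (cdf μ c) := by
    filter_upwards [h.ae_mem_Icc] with y hy
    exact propext (h.strictMonoOn_cdf.lt_iff_lt hc hy).symm
  have hinter : Ioi (cdf μ c) ∩ Icc (0 : ℝ) 1 = Ioc (cdf μ c) 1 := by
    ext q
    simp only [mem_inter_iff, mem_Ioi, mem_Icc, mem_Ioc]
    exact and_congr_right fun hq => and_iff_right ((cdf_nonneg μ c).trans hq.le)
  rw [setIntegral_congr_set hpre, ← setIntegral_map measurableSet_Ioi
    (by rwa [h.map_cdf]) (monotone_cdf μ).measurable.aemeasurable, h.map_cdf,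
    Measure.restrict_restrict measurableSet_Ioi, hinter,
    intervalIntegral.integral_of_le (cdf_le_one μ c)]

theorem integrable_comp_cdf_iff (h : IsValuationLaw μ f a b) {φ : ℝ → ℝ}
    (hφ : AEStronglyMeasurable φ (volume.restrict (Icc 0 1))) :
    Integrable (fun z => φ (cdf μ z)) μ ↔ IntegrableOn φ (Icc 0 1) := by
  rw [IntegrableOn, ← h.map_cdf]
  exact (integrable_map_measure (by rwa [h.map_cdf]) (monotone_cdf μ).measurable.aemeasurable).symm

/-! ### Virtual valuations -/

theorem integrable_virtualVal (h : IsValuationLaw μ f a b) : Integrable (virtualVal μ f) μ := by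
  rw [h.integrable_iff]
  refine IntegrableOn.congr_fun (f := fun z => 1 - cdf μ z) ?_
    (fun z hz => (h.density_mul_virtualVal hz).symm) measurableSet_Icc
  exact (continuous_const.sub h.continuous_cdf).continuousOn.integrableOn_Icc

theorem aestronglyMeasurable_hFun (h : IsValuationLaw μ f a b) :
    AEStronglyMeasurable (hFun μ f a b) (volume.restrict (Icc 0 1)) :=
  (h.measurable_virtualVal.comp_aemeasurable
    (aemeasurable_restrict_of_monotoneOn measurableSet_Icc
      h.monotoneOn_cdfInv)).aestronglyMeasurable

theorem ae_hFun_cdf (h : IsValuationLaw μ f a b) :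
    (fun z => hFun μ f a b (cdf μ z)) =ᵐ[μ] virtualVal μ f := by
  filter_upwards [h.ae_mem_Icc] with z hz
  rw [hFun, h.cdfInv_cdf hz]

theorem integrableOn_hFun (h : IsValuationLaw μ f a b) : IntegrableOn (hFun μ f a b) (Icc 0 1) :=
  (h.integrable_comp_cdf_iff h.aestronglyMeasurable_hFun).1
    (h.integrable_virtualVal.congr h.ae_hFun_cdf.symm)

theorem intervalIntegrable_hFun (h : IsValuationLaw μ f a b) {q r : ℝ} (hq : q ∈ Icc (0 : ℝ) 1)
    (hr : r ∈ Icc (0 : ℝ) 1) : IntervalIntegrable (hFun μ f a b) volume q r :=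
  (h.integrableOn_hFun.mono_set (uIcc_subset_Icc hq hr)).intervalIntegrable

theorem continuousOn_HFun (h : IsValuationLaw μ f a b) : ContinuousOn (HFun μ f a b) (Icc 0 1) := by
  rw [← uIcc_of_le (zero_le_one (α := ℝ))]
  exact intervalIntegral.continuousOn_primitive_interval <| by
    rw [uIcc_of_le zero_le_one]; exact h.integrableOn_hFun

theorem HFun_nonneg (h : IsValuationLaw μ f a b) {q : ℝ} (hq : q ∈ Icc (0 : ℝ) 1) :
    0 ≤ HFun μ f a b q :=
  intervalIntegral.integral_nonneg hq.1 fun _ hr =>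
    h.virtualVal_nonneg (h.cdfInv_mem ⟨hr.1, hr.2.trans hq.2⟩)

theorem setIntegral_Ioi_virtualVal (h : IsValuationLaw μ f a b) {c : ℝ} (hc : c ∈ Icc a b) :
    ∫ z in Ioi c, virtualVal μ f z ∂μ = HFun μ f a b 1 - HFun μ f a b (cdf μ c) := by
  rw [setIntegral_congr_ae measurableSet_Ioi (h.ae_hFun_cdf.symm.mono fun _ hz _ => hz),
    h.setIntegral_Ioi_comp_cdf h.aestronglyMeasurable_hFun hc, HFun, HFun,
    intervalIntegral.integral_interval_sub_left
      (h.intervalIntegrable_hFun ⟨le_rfl, zero_le_one⟩ ⟨zero_le_one, le_rfl⟩)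
      (h.intervalIntegrable_hFun ⟨le_rfl, zero_le_one⟩ (cdf_mem_Icc μ c))]

/-! ### Ironing -/

theorem convexOn_GFun (h : IsValuationLaw μ f a b) : ConvexOn ℝ (Icc 0 1) (GFun μ f a b) :=
  convexOn_convexHullFun h.continuousOn_HFun

theorem continuousOn_GFun (h : IsValuationLaw μ f a b) : ContinuousOn (GFun μ f a b) (Icc 0 1) :=
  continuousOn_convexHullFun h.continuousOn_HFun

theorem GFun_zero (h : IsValuationLaw μ f a b) : GFun μ f a b 0 = 0 :=
  (convexHullFun_endpoint h.continuousOn_HFun (.inl rfl)).trans intervalIntegral.integral_same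

theorem GFun_one (h : IsValuationLaw μ f a b) : GFun μ f a b 1 = HFun μ f a b 1 :=
  convexHullFun_endpoint h.continuousOn_HFun (.inr rfl)

theorem GFun_le_HFun (h : IsValuationLaw μ f a b) {q : ℝ} (hq : q ∈ Icc (0 : ℝ) 1) :
    GFun μ f a b q ≤ HFun μ f a b q :=
  convexHullFun_le h.continuousOn_HFun hq

theorem GFun_nonneg (h : IsValuationLaw μ f a b) {q : ℝ} (hq : q ∈ Icc (0 : ℝ) 1) :
    0 ≤ GFun μ f a b q :=
  IsConvexMinorant.le_convexHullFun (φ := fun _ => 0)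
    ⟨convexOn_const 0 (convex_Icc 0 1), fun _ => h.HFun_nonneg⟩ hq

theorem hasDerivWithinAt_GFun (h : IsValuationLaw μ f a b) {q : ℝ} (hq : q ∈ Ioo (0 : ℝ) 1) :
    HasDerivWithinAt (GFun μ f a b) (gFun μ f a b q) (Ioi q) q := by
  rw [gFun, if_pos hq.2]
  exact h.convexOn_GFun.hasDerivWithinAt_rightDeriv_of_mem_interior (by rwa [interior_Icc])

theorem slope_zero_GFun_nonneg (h : IsValuationLaw μ f a b) {q : ℝ} (hq : q ∈ Icc (0 : ℝ) 1) :
    0 ≤ slope (GFun μ f a b) 0 q := by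
  rw [slope_def_field, h.GFun_zero, sub_zero, sub_zero]
  exact div_nonneg (h.GFun_nonneg hq) hq.1

theorem gFun_le_slope (h : IsValuationLaw μ f a b) {q r : ℝ} (hq : 0 ≤ q) (hqr : q < r)
    (hr : r < 1) : gFun μ f a b q ≤ slope (GFun μ f a b) q r := by
  have hr' : r ∈ Icc (0 : ℝ) 1 := ⟨hq.trans hqr.le, hr.le⟩
  by_cases hd : DifferentiableWithinAt ℝ (GFun μ f a b) (Ioi q) q
  · rw [gFun, if_pos (hqr.trans hr)]
    exact h.convexOn_GFun.le_slope_of_hasDerivWithinAt_Ioi ⟨hq, (hqr.trans hr).le⟩ hr' hqr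
      hd.hasDerivWithinAt
  -- Only at `0` can the right derivative fail to exist, and then its junk value is `0`.
  · obtain rfl : q = 0 := (hq.eq_or_lt.resolve_right fun hq0 =>
      hd (h.hasDerivWithinAt_GFun ⟨hq0, hqr.trans hr⟩).differentiableWithinAt).symm
    rw [gFun, if_pos one_pos, derivWithin_zero_of_not_differentiableWithinAt hd]
    exact h.slope_zero_GFun_nonneg hr'

theorem slope_le_gFun (h : IsValuationLaw μ f a b) {q r : ℝ} (hq : 0 ≤ q) (hqr : q < r)
    (hr : r < 1) : slope (GFun μ f a b) q r ≤ gFun μ f a b r := by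
  have hr' : r ∈ interior (Icc (0 : ℝ) 1) := by
    rw [interior_Icc]; exact ⟨hq.trans_lt hqr, hr⟩
  rw [gFun, if_pos hr]
  exact (h.convexOn_GFun.slope_le_leftDeriv_of_mem_interior ⟨hq, (hqr.trans hr).le⟩ hr' hqr).trans
    (h.convexOn_GFun.leftDeriv_le_rightDeriv_of_mem_interior hr')

theorem monotoneOn_gFun (h : IsValuationLaw μ f a b) : MonotoneOn (gFun μ f a b) (Ico 0 1) := by
  intro q hq r hr hqr
  rcases hqr.eq_or_lt with rfl | hlt
  · exact le_rfl
  · exact (h.gFun_le_slope hq.1 hlt hr.2).trans (h.slope_le_gFun hq.1 hlt hr.2)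

theorem gFun_nonneg (h : IsValuationLaw μ f a b) {q : ℝ} (hq : q ∈ Ioo (0 : ℝ) 1) :
    0 ≤ gFun μ f a b q :=
  (h.slope_zero_GFun_nonneg (Ioo_subset_Icc_self hq)).trans (h.slope_le_gFun le_rfl hq.1 hq.2)

theorem integrableOn_gFun (h : IsValuationLaw μ f a b) : IntegrableOn (gFun μ f a b) (Icc 0 1) := by
  rw [integrableOn_Icc_iff_integrableOn_Ioc]
  exact intervalIntegral.integrableOn_deriv_right_of_nonneg h.continuousOn_GFun
    (fun q hq => h.hasDerivWithinAt_GFun hq) fun q hq => h.gFun_nonneg hq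

theorem integrable_ironedVal (h : IsValuationLaw μ f a b) : Integrable (ironedVal μ f a b) μ :=
  (h.integrable_comp_cdf_iff (measurable_gFun μ f a b).aestronglyMeasurable).2 h.integrableOn_gFun

theorem setIntegral_Ioi_ironedVal (h : IsValuationLaw μ f a b) {c : ℝ} (hc : c ∈ Icc a b) :
    ∫ z in Ioi c, ironedVal μ f a b z ∂μ = GFun μ f a b 1 - GFun μ f a b (cdf μ c) := by
  have hsub : uIcc (cdf μ c) 1 ⊆ Icc 0 1 :=
    uIcc_subset_Icc (cdf_mem_Icc μ c) (right_mem_Icc.2 zero_le_one)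
  refine (h.setIntegral_Ioi_comp_cdf (measurable_gFun μ f a b).aestronglyMeasurable hc).trans ?_
  refine intervalIntegral.integral_eq_sub_of_hasDeriv_right (h.continuousOn_GFun.mono hsub)
    (fun q hq => h.hasDerivWithinAt_GFun ?_) (h.integrableOn_gFun.mono_set hsub).intervalIntegrable
  rw [min_eq_left (cdf_le_one μ c), max_eq_right (cdf_le_one μ c)] at hq
  exact ⟨(cdf_nonneg μ c).trans_lt hq.1, hq.2⟩

theorem monotoneOn_ironedVal (h : IsValuationLaw μ f a b) :
    MonotoneOn (ironedVal μ f a b) (Ico a b) := by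
  have hmem : ∀ z ∈ Ico a b, cdf μ z ∈ Ico (0 : ℝ) 1 := fun z hz =>
    ⟨cdf_nonneg μ z, h.cdf_right ▸
      h.strictMonoOn_cdf (Ico_subset_Icc_self hz) (right_mem_Icc.2 h.lt.le) hz.2⟩
  exact h.monotoneOn_gFun.comp ((monotone_cdf μ).monotoneOn _) hmem

end IsValuationLaw

/-- The vertical distance between `H` and its convex hull at the quantile of `z`. -/
def ironingGap (μ : Measure ℝ) (f : ℝ → ℝ) (a b z : ℝ) : ℝ :=
  HFun μ f a b (cdf μ z) - GFun μ f a b (cdf μ z)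

/-- The valuations in the ironed intervals, where the convex hull is strictly below `H`. -/
def ironedSet (μ : Measure ℝ) (f : ℝ → ℝ) (a b : ℝ) : Set ℝ :=
  {z | 0 < ironingGap μ f a b z}

namespace IsValuationLaw

variable {μ : Measure ℝ} [IsProbabilityMeasure μ] {f : ℝ → ℝ} {a b : ℝ}

theorem ironingGap_nonneg (h : IsValuationLaw μ f a b) (z : ℝ) : 0 ≤ ironingGap μ f a b z :=
  sub_nonneg.2 (h.GFun_le_HFun (cdf_mem_Icc μ z))

theorem continuous_ironingGap (h : IsValuationLaw μ f a b) : Continuous (ironingGap μ f a b) :=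
  (h.continuousOn_HFun.comp_continuous h.continuous_cdf (cdf_mem_Icc μ)).sub
    (h.continuousOn_GFun.comp_continuous h.continuous_cdf (cdf_mem_Icc μ))

theorem isOpen_ironedSet (h : IsValuationLaw μ f a b) : IsOpen (ironedSet μ f a b) :=
  isOpen_lt continuous_const h.continuous_ironingGap

theorem ironedSet_subset_Ioo (h : IsValuationLaw μ f a b) : ironedSet μ f a b ⊆ Ioo a b :=
  fun z hz => h.cdf_mem_Ioo_iff.1 <|
    mem_Ioo_of_convexHullFun_lt h.continuousOn_HFun (cdf_mem_Icc μ z) (sub_pos.1 hz)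

theorem setIntegral_Ioi_ironedVal_sub_virtualVal (h : IsValuationLaw μ f a b) {c : ℝ}
    (hc : c ∈ Icc a b) :
    ∫ z in Ioi c, (ironedVal μ f a b z - virtualVal μ f z) ∂μ = ironingGap μ f a b c := by
  rw [integral_sub h.integrable_ironedVal.integrableOn h.integrable_virtualVal.integrableOn,
    h.setIntegral_Ioi_virtualVal hc, h.setIntegral_Ioi_ironedVal hc, h.GFun_one, ironingGap]
  ring

theorem eventually_ironedVal_eq (h : IsValuationLaw μ f a b) {z : ℝ} (hz : z ∈ ironedSet μ f a b) :
    ∀ᶠ y in 𝓝 z, ironedVal μ f a b y = ironedVal μ f a b z := by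
  obtain ⟨k, c, hG⟩ :=
    convexHullFun_eventuallyEq_affine h.continuousOn_HFun (cdf_mem_Icc μ z) (sub_pos.1 hz)
  have hlt : ∀ᶠ q in 𝓝 (cdf μ z), q < 1 :=
    gt_mem_nhds (h.cdf_mem_Ioo_iff.2 (h.ironedSet_subset_Ioo hz)).2
  have hg : ∀ᶠ q in 𝓝 (cdf μ z), gFun μ f a b q = k := by
    filter_upwards [hG.eventually_nhds, hlt] with q hq hq1
    have hd : HasDerivAt (fun r : ℝ => k * r + c) k q := by
      simpa only [id, mul_one] using ((hasDerivAt_id q).const_mul k).add_const c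
    rw [gFun, if_pos hq1]
    exact (hd.congr_of_eventuallyEq hq).hasDerivWithinAt.derivWithin (uniqueDiffWithinAt_Ioi q)
  filter_upwards [h.continuous_cdf.continuousAt.eventually hg] with y hy
  exact hy.trans hg.self_of_nhds.symm

end IsValuationLaw

/-! ### Integrating against a monotone allocation rule -/

section LayerCake

variable {α : Type*} [MeasurableSpace α] {ν : Measure α} {ψ x : α → ℝ} {C : ℝ}

theorem integrable_indicator_lt (hψ : Integrable ψ ν) (hx : Measurable x) :
    Integrable ({p : α × ℝ | p.2 < x p.1}.indicator fun p => ψ p.1)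
      (ν.prod (volume.restrict (Ico 0 C))) :=
  (hψ.comp_fst _).indicator (measurableSet_lt measurable_snd (hx.comp measurable_fst))

theorem integral_indicator_lt (hx : Measurable x) (s : ℝ) :
    ∫ z, {p : α × ℝ | p.2 < x p.1}.indicator (fun p => ψ p.1) (z, s) ∂ν =
      ∫ z in {z | s < x z}, ψ z ∂ν :=
  integral_indicator (measurableSet_lt measurable_const hx)

theorem integrableOn_setIntegral_lt [SFinite ν] (hψ : Integrable ψ ν) (hx : Measurable x) :
    IntegrableOn (fun s => ∫ z in {z | s < x z}, ψ z ∂ν) (Ico 0 C) := by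
  have hint := (integrable_indicator_lt (C := C) hψ hx).integral_prod_right
  simp_rw [integral_indicator_lt hx] at hint
  exact hint

theorem integral_mul_eq_integral_setIntegral_lt [SFinite ν] (hψ : Integrable ψ ν)
    (hx : Measurable x) (hxC : ∀ z, x z ∈ Icc 0 C) :
    ∫ z, ψ z * x z ∂ν = ∫ s in Ico 0 C, ∫ z in {z | s < x z}, ψ z ∂ν := by
  have hlayer (z : α) : ∫ s in Ico 0 C, {p : α × ℝ | p.2 < x p.1}.indicator (fun p => ψ p.1) (z, s)
      = ψ z * x z := by
    have hslice : (fun s => {p : α × ℝ | p.2 < x p.1}.indicator (fun p => ψ p.1) (z, s)) =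
        (Iio (x z)).indicator fun _ => ψ z := by
      ext s
      simp only [indicator, mem_ofPred_eq, mem_Iio]
    rw [hslice, integral_indicator_const _ measurableSet_Iio,
      measureReal_restrict_apply measurableSet_Iio, inter_comm, Ico_inter_Iio,
      min_eq_right (hxC z).2, Real.volume_real_Ico_of_le (hxC z).1, smul_eq_mul, sub_zero, mul_comm]
  have hswap := integral_integral_swap
    (f := fun z s => {p : α × ℝ | p.2 < x p.1}.indicator (fun p => ψ p.1) (z, s))
    (integrable_indicator_lt (C := C) hψ hx)
  simpa only [hlayer, integral_indicator_lt hx] using hswap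

end LayerCake

/-- The point of `[a, b]` at which the monotone function `x` passes the level `s`, and `b` if `x`
stays below `s`. -/
def threshold (a b : ℝ) (x : ℝ → ℝ) (s : ℝ) : ℝ :=
  sInf (insert b {z ∈ Icc a b | s < x z})

section Threshold

variable {a b s z : ℝ} {x : ℝ → ℝ}

theorem bddBelow_insert_sep_Icc (p : ℝ → Prop) : BddBelow (insert b {z ∈ Icc a b | p z}) :=
  (bddBelow_Icc.mono (sep_subset (Icc a b) p)).insert b

theorem threshold_mem_Icc (hab : a ≤ b) : threshold a b x s ∈ Icc a b := by
  refine ⟨le_csInf (insert_nonempty _ _) ?_, csInf_le (bddBelow_insert_sep_Icc _) (.inl rfl)⟩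
  rintro z (rfl | hz)
  exacts [hab, hz.1.1]

theorem threshold_le (hz : z ∈ Icc a b) (hlt : s < x z) : threshold a b x s ≤ z :=
  csInf_le (bddBelow_insert_sep_Icc _) (.inr ⟨hz, hlt⟩)

theorem lt_of_threshold_lt (hx : MonotoneOn x (Icc a b)) (hz : z ∈ Icc a b)
    (hlt : threshold a b x s < z) : s < x z := by
  obtain ⟨y, rfl | hy, hyz⟩ := exists_lt_of_csInf_lt (insert_nonempty _ _) hlt
  · exact absurd hz.2 hyz.not_ge
  · exact hy.2.trans_le (hx hy.1 hz hyz.le)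

theorem threshold_mem_Icc_of_mem_Ioo (hx : MonotoneOn x (Icc a b)) {y₁ y₂ : ℝ} (h₁ : y₁ ∈ Icc a b)
    (h₂ : y₂ ∈ Icc a b) (hs : s ∈ Ioo (x y₁) (x y₂)) : threshold a b x s ∈ Icc y₁ y₂ :=
  ⟨not_lt.1 fun hlt => (lt_of_threshold_lt hx h₁ hlt).not_ge hs.1.le, threshold_le h₂ hs.2⟩

theorem not_eventually_eq_threshold (hx : MonotoneOn x (Icc a b))
    (hc : threshold a b x s ∈ Ioo a b) :
    ¬∀ᶠ y in 𝓝 (threshold a b x s), x y = x (threshold a b x s) := by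
  intro hconst
  have hev := hconst.and (Icc_mem_nhds hc.1 hc.2)
  obtain ⟨y, ⟨hy, hyI⟩, hylt⟩ := ((hev.filter_mono nhdsWithin_le_nhds).and
    (self_mem_nhdsWithin (s := Iio (threshold a b x s)))).exists
  obtain ⟨y', ⟨hy', hyI'⟩, hygt⟩ := ((hev.filter_mono nhdsWithin_le_nhds).and
    (self_mem_nhdsWithin (s := Ioi (threshold a b x s)))).exists
  have hs : s < x y := (lt_of_threshold_lt hx hyI' hygt).trans_eq (hy'.trans hy.symm)
  exact (threshold_le hyI hs).not_gt hylt

end Threshold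

/-- The gain from replacing the virtual valuation by the ironed one in the payoff from the
allocation rule `x`. For monotone `x` it is the mean of the ironing gap over the thresholds of `x`,
hence nonnegative. -/
def ironingLoss (μ : Measure ℝ) (f : ℝ → ℝ) (a b : ℝ) (x : ℝ → ℝ) : ℝ :=
  ∫ z, (ironedVal μ f a b z - virtualVal μ f z) * x z ∂μ

namespace IsValuationLaw

variable {μ : Measure ℝ} {f : ℝ → ℝ} {a b C : ℝ} {x : ℝ → ℝ}

theorem ae_eq_Ioi_threshold (h : IsValuationLaw μ f a b) (hmono : MonotoneOn x (Icc a b)) (s : ℝ) :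
    {z | s < x z} =ᵐ[μ] Ioi (threshold a b x s) := by
  have hne : ∀ᵐ z ∂μ, z ≠ threshold a b x s :=
    measure_eq_zero_iff_ae_notMem.1 (h.measure_singleton _)
  filter_upwards [h.ae_mem_Icc, hne] with z hz hzne
  exact propext ⟨fun hlt => (threshold_le hz hlt).lt_of_ne' hzne, lt_of_threshold_lt hmono hz⟩

variable [IsProbabilityMeasure μ]

theorem integrable_ironedVal_sub_virtualVal (h : IsValuationLaw μ f a b) :
    Integrable (fun z => ironedVal μ f a b z - virtualVal μ f z) μ :=
  h.integrable_ironedVal.sub h.integrable_virtualVal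

theorem setIntegral_lt_eq_ironingGap (h : IsValuationLaw μ f a b) (hmono : MonotoneOn x (Icc a b))
    (s : ℝ) : ∫ z in {z | s < x z}, (ironedVal μ f a b z - virtualVal μ f z) ∂μ =
      ironingGap μ f a b (threshold a b x s) := by
  rw [setIntegral_congr_set (h.ae_eq_Ioi_threshold hmono s),
    h.setIntegral_Ioi_ironedVal_sub_virtualVal (threshold_mem_Icc h.lt.le)]

theorem integrableOn_ironingGap_threshold (h : IsValuationLaw μ f a b) (hx : Measurable x)
    (hmono : MonotoneOn x (Icc a b)) :
    IntegrableOn (fun s => ironingGap μ f a b (threshold a b x s)) (Ico 0 C) := by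
  simpa only [h.setIntegral_lt_eq_ironingGap hmono] using
    integrableOn_setIntegral_lt h.integrable_ironedVal_sub_virtualVal hx

theorem ironingLoss_eq_integral_ironingGap (h : IsValuationLaw μ f a b) (hx : Measurable x)
    (hmono : MonotoneOn x (Icc a b)) (hxC : ∀ z, x z ∈ Icc 0 C) :
    ironingLoss μ f a b x = ∫ s in Ico 0 C, ironingGap μ f a b (threshold a b x s) := by
  simpa only [ironingLoss, h.setIntegral_lt_eq_ironingGap hmono] using
    integral_mul_eq_integral_setIntegral_lt
      h.integrable_ironedVal_sub_virtualVal hx hxC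

theorem ironingLoss_nonneg (h : IsValuationLaw μ f a b) (hx : Measurable x)
    (hmono : MonotoneOn x (Icc a b)) (hxC : ∀ z, x z ∈ Icc 0 C) : 0 ≤ ironingLoss μ f a b x := by
  rw [h.ironingLoss_eq_integral_ironingGap hx hmono hxC]
  exact integral_nonneg fun s => h.ironingGap_nonneg _

theorem ironingLoss_eq_zero_iff_ae (h : IsValuationLaw μ f a b) (hx : Measurable x)
    (hmono : MonotoneOn x (Icc a b)) (hxC : ∀ z, x z ∈ Icc 0 C) :
    ironingLoss μ f a b x = 0 ↔
      ∀ᵐ s ∂volume.restrict (Ico 0 C), ironingGap μ f a b (threshold a b x s) = 0 := by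
  rw [h.ironingLoss_eq_integral_ironingGap hx hmono hxC]
  exact integral_eq_zero_iff_of_nonneg (fun s => h.ironingGap_nonneg _)
    (h.integrableOn_ironingGap_threshold hx hmono)

theorem eq_of_ironingGap_threshold_ae_eq_zero (h : IsValuationLaw μ f a b)
    (hmono : MonotoneOn x (Icc a b)) (hxC : ∀ z, x z ∈ Icc 0 C)
    (hzero : ∀ᵐ s ∂volume.restrict (Ico 0 C), ironingGap μ f a b (threshold a b x s) = 0)
    {y₁ y₂ : ℝ} (hy : y₁ ≤ y₂) (hsub : Icc y₁ y₂ ⊆ ironedSet μ f a b) : x y₁ = x y₂ := by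
  have hmem : ∀ y ∈ Icc y₁ y₂, y ∈ Icc a b := fun y hy =>
    Ioo_subset_Icc_self (h.ironedSet_subset_Ioo (hsub hy))
  have h₁ := hmem y₁ (left_mem_Icc.2 hy)
  have h₂ := hmem y₂ (right_mem_Icc.2 hy)
  have hlevels : Ioo (x y₁) (x y₂) ⊆ Ico 0 C := fun s hs =>
    ⟨(hxC y₁).1.trans hs.1.le, hs.2.trans_le (hxC y₂).2⟩
  have hnull : volume (Ioo (x y₁) (x y₂)) = 0 := by
    refine measure_eq_zero_iff_ae_notMem.2 ?_
    filter_upwards [(ae_restrict_iff' measurableSet_Ico).1 hzero] with s hs hmem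
    exact (hsub (threshold_mem_Icc_of_mem_Ioo hmono h₁ h₂ hmem)).ne' (hs (hlevels hmem))
  rw [Real.volume_Ioo, ENNReal.ofReal_eq_zero] at hnull
  exact (hmono h₁ h₂ hy).antisymm (sub_nonpos.1 hnull)

theorem ironingLoss_eq_zero_iff (h : IsValuationLaw μ f a b) (hx : Measurable x)
    (hmono : MonotoneOn x (Icc a b)) (hxC : ∀ z, x z ∈ Icc 0 C) :
    ironingLoss μ f a b x = 0 ↔ ∀ z ∈ ironedSet μ f a b, HasDerivAt x 0 z := by
  rw [h.ironingLoss_eq_zero_iff_ae hx hmono hxC]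
  refine ⟨fun hzero z hz => ?_, fun hderiv => ae_of_all _ fun s => ?_⟩
  · obtain ⟨ε, hε, hball⟩ := Metric.isOpen_iff.1 h.isOpen_ironedSet z hz
    have hconst : ∀ y ∈ Metric.ball z ε, x y = x z := fun y hy => by
      have hsub := ((convex_ball z ε).ordConnected.uIcc_subset hy (Metric.mem_ball_self hε)).trans
        hball
      rcases le_total y z with hyz | hzy
      · rw [uIcc_of_le hyz] at hsub
        exact h.eq_of_ironingGap_threshold_ae_eq_zero hmono hxC hzero hyz hsub
      · rw [uIcc_of_ge hzy] at hsub
        exact (h.eq_of_ironingGap_threshold_ae_eq_zero hmono hxC hzero hzy hsub).symm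
    exact (hasDerivAt_const z (x z)).congr_of_eventuallyEq
      (Filter.mem_of_superset (Metric.ball_mem_nhds z hε) hconst)
  · by_contra hne
    have hc : threshold a b x s ∈ ironedSet μ f a b := (h.ironingGap_nonneg _).lt_of_ne' hne
    have hopen := h.isOpen_ironedSet.isOpen_inter_preimage_of_deriv_eq_zero
      (fun z hz => (hderiv z hz).differentiableAt.differentiableWithinAt)
      (fun z hz => (hderiv z hz).deriv) {x (threshold a b x s)}
    refine not_eventually_eq_threshold hmono (h.ironedSet_subset_Ioo hc) ?_
    filter_upwards [hopen.mem_nhds ⟨hc, mem_singleton _⟩] with y hy using hy.2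

end IsValuationLaw

/-! ### Envelope formula -/

/-- `x z` is a subgradient of `u` at every point `z` of `s`. With `u` the interim utility under
truthtelling and `x` the interim allocation, this is Bayesian incentive compatibility. -/
def IsSubgradientOn (u x : ℝ → ℝ) (s : Set ℝ) : Prop :=
  ∀ z ∈ s, ∀ z' ∈ s, u z + (z' - z) * x z ≤ u z'

namespace IsSubgradientOn

variable {u x : ℝ → ℝ} {s : Set ℝ} {y z : ℝ}

theorem le_slope (h : IsSubgradientOn u x s) (hy : y ∈ s) (hz : z ∈ s) (hyz : y < z) :
    x y ≤ slope u y z := by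
  rw [slope_def_field, le_div_iff₀ (sub_pos.2 hyz)]
  linarith [h y hy z hz]

theorem slope_le (h : IsSubgradientOn u x s) (hy : y ∈ s) (hz : z ∈ s) (hyz : y < z) :
    slope u y z ≤ x z := by
  rw [slope_def_field, div_le_iff₀ (sub_pos.2 hyz)]
  linarith [h z hz y hy]

theorem monotoneOn (h : IsSubgradientOn u x s) : MonotoneOn x s := by
  intro y hy z hz hyz
  rcases hyz.eq_or_lt with rfl | hlt
  · exact le_rfl
  · exact (h.le_slope hy hz hlt).trans (h.slope_le hy hz hlt)

theorem slope_mem_uIcc (h : IsSubgradientOn u x s) (hy : y ∈ s) (hz : z ∈ s) (hyz : y ≠ z) :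
    slope u y z ∈ uIcc (x y) (x z) := by
  rcases hyz.lt_or_gt with hlt | hlt
  · exact Icc_subset_uIcc ⟨h.le_slope hy hz hlt, h.slope_le hy hz hlt⟩
  · rw [slope_comm]
    exact Icc_subset_uIcc' ⟨h.le_slope hz hy hlt, h.slope_le hz hy hlt⟩

theorem hasDerivAt (h : IsSubgradientOn u x s) (hs : s ∈ 𝓝 y) (hx : ContinuousAt x y) :
    HasDerivAt u (x y) y := by
  have hx' : Tendsto x (𝓝[≠] y) (𝓝 (x y)) := hx.tendsto.mono_left nhdsWithin_le_nhds
  have hmin : Tendsto (fun z => min (x y) (x z)) (𝓝[≠] y) (𝓝 (x y)) := by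
    simpa only [min_self] using tendsto_const_nhds (x := x y).min hx'
  have hmax : Tendsto (fun z => max (x y) (x z)) (𝓝[≠] y) (𝓝 (x y)) := by
    simpa only [max_self] using tendsto_const_nhds (x := x y).max hx'
  have hmem : ∀ᶠ z in 𝓝[≠] y, slope u y z ∈ uIcc (x y) (x z) := by
    filter_upwards [nhdsWithin_le_nhds hs, self_mem_nhdsWithin] with z hz hzy
    exact h.slope_mem_uIcc (mem_of_mem_nhds hs) hz (Ne.symm hzy)
  rw [hasDerivAt_iff_tendsto_slope]
  exact tendsto_of_tendsto_of_tendsto_of_le_of_le' hmin hmax (hmem.mono fun _ hz => hz.1)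
    (hmem.mono fun _ hz => hz.2)

theorem lipschitzOnWith (h : IsSubgradientOn u x s) {K : NNReal} (hK : ∀ z ∈ s, |x z| ≤ K) :
    LipschitzOnWith K u s := by
  refine LipschitzOnWith.of_le_add_mul K fun y hy z hz => ?_
  have hbound : (y - z) * x y ≤ K * dist y z := by
    rw [Real.dist_eq, mul_comm (K : ℝ)]
    exact (le_abs_self _).trans ((abs_mul _ _).trans_le (by gcongr; exact hK y hy))
  linarith [h y hy z hz]

variable {a b : ℝ}

theorem continuousOn (h : IsSubgradientOn u x (Icc a b)) : ContinuousOn u (Icc a b) := by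
  refine (h.lipschitzOnWith (K := ⟨max |x a| |x b|, by positivity⟩) fun z hz => ?_).continuousOn
  have hab := hz.1.trans hz.2
  exact abs_le_max_abs_abs (h.monotoneOn (left_mem_Icc.2 hab) hz hz.1)
    (h.monotoneOn hz (right_mem_Icc.2 hab) hz.2)

theorem integral_eq_sub (h : IsSubgradientOn u x (Icc a b)) (hz : z ∈ Icc a b) :
    ∫ t in a..z, x t = u z - u a := by
  have hsub : uIcc a z ⊆ Icc a b := by
    rw [uIcc_of_le hz.1]
    exact Icc_subset_Icc_right hz.2
  refine integral_eq_of_hasDerivAt_off_countable u x h.monotoneOn.countable_not_continuousWithinAt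
    (h.continuousOn.mono hsub) ?_ (h.monotoneOn.mono hsub).intervalIntegrable
  rintro y ⟨hy, hcont⟩
  rw [min_eq_left hz.1, max_eq_right hz.1] at hy
  have hnhds : Icc a b ∈ 𝓝 y := Icc_mem_nhds hy.1 (hy.2.trans_le hz.2)
  exact h.hasDerivAt hnhds <| by_contra fun hc =>
    hcont ⟨mem_of_mem_nhds hnhds, fun hw => hc (hw.continuousAt hnhds)⟩

end IsSubgradientOn

theorem isSubgradientOn_integral {a b : ℝ} {x : ℝ → ℝ} (hx : MonotoneOn x (Icc a b)) :
    IsSubgradientOn (fun z => ∫ t in a..z, x t) x (Icc a b) := by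
  intro z hz z' hz'
  have hint {y y' : ℝ} (hy : y ∈ Icc a b) (hy' : y' ∈ Icc a b) : IntervalIntegrable x volume y y' :=
    (hx.mono (uIcc_subset_Icc hy hy')).intervalIntegrable
  have ha : a ∈ Icc a b := left_mem_Icc.2 (hz.1.trans hz.2)
  have hdiff := intervalIntegral.integral_interval_sub_left (hint ha hz') (hint ha hz)
  have hconst : ∫ _ in z..z', x z = (z' - z) * x z := by
    rw [intervalIntegral.integral_const, smul_eq_mul]
  suffices hle : ∫ _ in z..z', x z ≤ ∫ t in z..z', x t by
    change (∫ t in a..z, x t) + (z' - z) * x z ≤ ∫ t in a..z', x t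
    linarith
  rcases le_total z z' with hzz | hzz
  · exact intervalIntegral.integral_mono_on hzz intervalIntegrable_const (hint hz hz')
      fun t ht => hx hz ⟨hz.1.trans ht.1, ht.2.trans hz'.2⟩ ht.1
  · rw [intervalIntegral.integral_symm, intervalIntegral.integral_symm z' z, neg_le_neg_iff]
    exact intervalIntegral.integral_mono_on hzz (hint hz' hz) intervalIntegrable_const
      fun t ht => hx ⟨hz'.1.trans ht.1, ht.2.trans hz.2⟩ hz ht.2

namespace IsValuationLaw

variable {μ : Measure ℝ} {f : ℝ → ℝ} {a b : ℝ} {x : ℝ → ℝ}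

theorem integral_eq_setIntegral_density_mul (h : IsValuationLaw μ f a b) (φ : ℝ → ℝ) :
    ∫ z, φ z ∂μ = ∫ z in Icc a b, f z * φ z := by
  have heq := integral_withDensity_eq_integral_toReal_smul (μ := volume.restrict (Icc a b))
    h.measurable_density.ennreal_ofReal (by simp) φ
  rw [← h.eq_withDensity] at heq
  rw [heq]
  refine setIntegral_congr_fun measurableSet_Icc fun z hz => ?_
  simp only [ENNReal.toReal_ofReal (h.density_pos z hz).le, smul_eq_mul]

theorem integral_primitive [IsProbabilityMeasure μ] (h : IsValuationLaw μ f a b)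
    (hx : IntegrableOn x (Icc a b)) :
    ∫ z, (∫ t in a..z, x t) ∂μ = ∫ z, virtualVal μ f z * x z ∂μ := by
  let below (z t : ℝ) : ℝ := {p : ℝ × ℝ | p.2 < p.1}.indicator (fun p => x p.2) (z, t)
  have hbelow_left (z : ℝ) : below z = (Iio z).indicator x := by
    ext t
    simp only [below, indicator, mem_ofPred_eq, mem_Iio]
  have hbelow_right (t : ℝ) : (fun z => below z t) = (Ioi t).indicator fun _ => x t := by
    ext z
    simp only [below, indicator, mem_ofPred_eq, mem_Ioi]
  have hint : Integrable (Function.uncurry below) (μ.prod (volume.restrict (Icc a b))) :=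
    (hx.comp_snd μ).indicator (measurableSet_lt measurable_snd measurable_fst)
  calc ∫ z, (∫ t in a..z, x t) ∂μ
      = ∫ z, (∫ t in Icc a b, below z t) ∂μ := by
        refine integral_congr_ae (h.ae_mem_Icc.mono fun z hz => ?_)
        have hIco : Iio z ∩ Icc a b = Ico a z := by
          ext t
          exact ⟨fun ht => ⟨ht.2.1, ht.1⟩, fun ht => ⟨ht.2, ht.1, ht.2.le.trans hz.2⟩⟩
        simp only [hbelow_left]
        rw [integral_indicator measurableSet_Iio, Measure.restrict_restrict measurableSet_Iio,
          hIco, integral_Ico_eq_integral_Ioc, intervalIntegral.integral_of_le hz.1]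
    _ = ∫ t in Icc a b, (∫ z, below z t ∂μ) := integral_integral_swap hint
    _ = ∫ t in Icc a b, (1 - cdf μ t) * x t := by
        simp only [hbelow_right, integral_indicator_const _ measurableSet_Ioi, smul_eq_mul]
        simp only [← compl_Iic, probReal_compl_eq_one_sub measurableSet_Iic, cdf_eq_real]
    _ = ∫ t in Icc a b, f t * (virtualVal μ f t * x t) := by
        refine setIntegral_congr_fun measurableSet_Icc fun t ht => ?_
        simp only [← mul_assoc, h.density_mul_virtualVal ht]
    _ = ∫ z, virtualVal μ f z * x z ∂μ := (h.integral_eq_setIntegral_density_mul _).symm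

end IsValuationLaw

/-! ### Redrawing the valuation of one agent -/

theorem measurePreserving_update {ι : Type*} [Fintype ι] [DecidableEq ι] {Y : ι → Type*}
    [∀ i, MeasurableSpace (Y i)] (ν : ∀ i, Measure (Y i)) [∀ i, IsProbabilityMeasure (ν i)]
    (i : ι) :
    MeasurePreserving (fun p : Y i × (∀ j, Y j) => Function.update p.2 i p.1)
      ((ν i).prod (Measure.pi ν)) (Measure.pi ν) := by
  have hm : Measurable fun p : Y i × (∀ j, Y j) => Function.update p.2 i p.1 :=
    measurable_update'.comp measurable_swap
  refine ⟨hm, (Measure.pi_eq fun s hs => ?_).symm⟩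
  have hpre : (fun p : Y i × (∀ j, Y j) => Function.update p.2 i p.1) ⁻¹' univ.pi s =
      s i ×ˢ univ.pi (Function.update s i univ) := by
    ext p
    simp only [mem_preimage, mem_univ_pi, mem_prod, mem_univ, true_and,
      Function.forall_update_iff p.2 fun j t => t ∈ s j,
      Function.forall_update_iff s fun j t => p.2 j ∈ t]
  have hprod : ∏ j, ν j (Function.update s i univ j) = ∏ j ∈ Finset.univ \ {i}, ν j (s j) := by
    simp only [Function.apply_update (fun j => ν j), measure_univ]
    rw [Finset.prod_update_of_mem (Finset.mem_univ i), one_mul]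
  rw [Measure.map_apply hm (MeasurableSet.univ_pi hs), hpre, Measure.prod_prod, Measure.pi_pi,
    hprod]
  exact (Finset.prod_eq_mul_prod_sdiff_singleton_of_mem (Finset.mem_univ i)
    fun j => ν j (s j)).symm

namespace Mechanism

variable {n : ℕ} {Ω : Type*} [MeasurableSpace Ω] {μ : Measure ℝ} {P : Measure Ω}
  [IsProbabilityMeasure μ] [IsProbabilityMeasure P]

instance : IsProbabilityMeasure (jointLaw n μ P) := by
  unfold jointLaw; infer_instance

theorem measurePreserving_update_jointLaw (i : Fin n) :
    MeasurePreserving (fun p : ℝ × ((Fin n → ℝ) × Ω) => (Function.update p.2.1 i p.1, p.2.2))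
      (μ.prod (jointLaw n μ P)) (jointLaw n μ P) :=
  ((measurePreserving_update (fun _ => μ) i).prod (MeasurePreserving.id P)).comp
    (measurePreserving_prodAssoc μ (Measure.pi fun _ : Fin n => μ) P).symm

theorem measurePreserving_eval_jointLaw (i : Fin n) :
    MeasurePreserving (fun q : (Fin n → ℝ) × Ω => q.1 i) (jointLaw n μ P) μ :=
  (measurePreserving_eval (fun _ : Fin n => μ) i).comp measurePreserving_fst

theorem ae_jointLaw_of_ae {p : ℝ → Prop} (hp : ∀ᵐ z ∂μ, p z) :
    ∀ᵐ q ∂jointLaw n μ P, ∀ i, p (q.1 i) :=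
  ae_all_iff.2 fun i => (measurePreserving_eval_jointLaw i).quasiMeasurePreserving.ae hp

theorem measurable_update_report (i : Fin n) (z : ℝ) :
    Measurable fun q : (Fin n → ℝ) × Ω => (Function.update q.1 i z, q.2) :=
  (measurable_update_left.comp measurable_fst).prodMk measurable_snd

theorem integral_jointLaw_eq_integral_integral_update (i : Fin n) {K : (Fin n → ℝ) × Ω → ℝ}
    (hK : Integrable K (jointLaw n μ P)) :
    ∫ q, K q ∂jointLaw n μ P =
      ∫ z, ∫ q, K (Function.update q.1 i z, q.2) ∂jointLaw n μ P ∂μ := by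
  have hmp := measurePreserving_update_jointLaw (μ := μ) (P := P) i
  refine Eq.trans ?_ (integral_prod _ ((hmp.integrable_comp hK.aestronglyMeasurable).2 hK))
  conv_lhs => rw [← hmp.map_eq]
  exact integral_map hmp.measurable.aemeasurable (by rw [hmp.map_eq]; exact hK.aestronglyMeasurable)

theorem measurable_integral_update (i : Fin n) {K : (Fin n → ℝ) × Ω → ℝ} (hK : Measurable K) :
    Measurable fun z => ∫ q, K (Function.update q.1 i z, q.2) ∂jointLaw n μ P :=
  (hK.comp (measurePreserving_update_jointLaw (μ := μ) (P := P) i).measurable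
    ).stronglyMeasurable.integral_prod_right'.measurable

end Mechanism

/-! ### Residual surplus as ironed virtual surplus minus ironing losses -/

namespace Mechanism

variable {n : ℕ} {Ω : Type*} [MeasurableSpace Ω]

/-- The allocation rule of `M` is measurable and serves agent `i` an amount in `[0, c i]`. -/
structure HasBoundedAlloc (M : Mechanism n Ω) (c : Fin n → ℝ) : Prop where
  measurable_alloc : ∀ i, Measurable fun q : (Fin n → ℝ) × Ω => M.alloc q.1 q.2 i
  alloc_mem_Icc : ∀ v ω, M.alloc v ω ∈ Icc 0 c

/-- Expected ironed virtual surplus `E[∑ᵢ ϑ̄(vᵢ) xᵢ(v)]`. -/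
def ironedSurplus (M : Mechanism n Ω) (μ : Measure ℝ) (f : ℝ → ℝ) (a b : ℝ) (P : Measure Ω) : ℝ :=
  ∫ q, ∑ i, ironedVal μ f a b (q.1 i) * M.alloc q.1 q.2 i ∂(jointLaw n μ P)

variable {μ : Measure ℝ} {P : Measure Ω} {f : ℝ → ℝ} {a b : ℝ} {X : Set (Fin n → ℝ)}
  {M : Mechanism n Ω} {c : Fin n → ℝ}

namespace HasBoundedAlloc

theorem norm_alloc_le (hM : M.HasBoundedAlloc c) (v : Fin n → ℝ) (ω : Ω) (i : Fin n) :
    ‖M.alloc v ω i‖ ≤ c i := by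
  rw [Real.norm_of_nonneg ((hM.alloc_mem_Icc v ω).1 i)]
  exact (hM.alloc_mem_Icc v ω).2 i

variable [IsProbabilityMeasure μ] [IsProbabilityMeasure P]

theorem measurable_interimAlloc (hM : M.HasBoundedAlloc c) (i : Fin n) :
    Measurable (M.interimAlloc μ P i) :=
  measurable_integral_update i (hM.measurable_alloc i)

theorem integrable_alloc_update (hM : M.HasBoundedAlloc c) (i : Fin n) (z : ℝ) :
    Integrable (fun q : (Fin n → ℝ) × Ω => M.alloc (Function.update q.1 i z) q.2 i)
      (jointLaw n μ P) :=
  .of_bound ((hM.measurable_alloc i).comp (measurable_update_report i z)).aestronglyMeasurable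
    (c i) (ae_of_all _ fun _ => hM.norm_alloc_le _ _ i)

theorem interimAlloc_mem_Icc (hM : M.HasBoundedAlloc c) (i : Fin n) (z : ℝ) :
    M.interimAlloc μ P i z ∈ Icc 0 (c i) := by
  refine ⟨integral_nonneg fun q => (hM.alloc_mem_Icc _ _).1 i, ?_⟩
  simpa only [interimAlloc, integral_const, probReal_univ, one_smul] using
    integral_mono (hM.integrable_alloc_update (μ := μ) (P := P) i z) (integrable_const (c i))
      fun q => (hM.alloc_mem_Icc _ _).2 i

theorem integrable_mul_alloc (hM : M.HasBoundedAlloc c) {ψ : ℝ → ℝ} (hψ : Integrable ψ μ)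
    (i : Fin n) :
    Integrable (fun q : (Fin n → ℝ) × Ω => ψ (q.1 i) * M.alloc q.1 q.2 i) (jointLaw n μ P) :=
  ((measurePreserving_eval_jointLaw i).integrable_comp_of_integrable hψ).mul_bdd
    (hM.measurable_alloc i).aestronglyMeasurable (ae_of_all _ fun _ => hM.norm_alloc_le _ _ i)

theorem integrable_mul_interimAlloc (hM : M.HasBoundedAlloc c) {ψ : ℝ → ℝ} (hψ : Integrable ψ μ)
    (i : Fin n) : Integrable (fun z => ψ z * M.interimAlloc μ P i z) μ := by
  refine hψ.mul_bdd (hM.measurable_interimAlloc i).aestronglyMeasurable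
    (c := c i) (ae_of_all _ fun z => ?_)
  have hz := hM.interimAlloc_mem_Icc (μ := μ) (P := P) i z
  rw [Real.norm_of_nonneg hz.1]
  exact hz.2

theorem integral_mul_alloc (hM : M.HasBoundedAlloc c) {ψ : ℝ → ℝ} (hψ : Integrable ψ μ)
    (i : Fin n) :
    ∫ q, ψ (q.1 i) * M.alloc q.1 q.2 i ∂jointLaw n μ P =
      ∫ z, ψ z * M.interimAlloc μ P i z ∂μ := by
  rw [integral_jointLaw_eq_integral_integral_update i (hM.integrable_mul_alloc hψ i)]
  simp only [Function.update_self, integral_const_mul, interimAlloc]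

end HasBoundedAlloc

namespace IsAdmissible

theorem hasBoundedAlloc (hM : M.IsAdmissible μ P a b X) (hX : X ⊆ Icc 0 c) :
    M.HasBoundedAlloc c :=
  ⟨hM.measurable_alloc, fun v ω => hX (hM.feasible v ω)⟩

theorem isSubgradientOn (hM : M.IsAdmissible μ P a b X) (i : Fin n) :
    IsSubgradientOn (fun z => M.interimUtil μ P i z z) (M.interimAlloc μ P i) (Icc a b) := by
  intro z hz z' hz'
  have hic := hM.incentive_compatible i z' hz' z hz
  simp only [interimUtil] at hic ⊢
  linarith

theorem interimUtil_eq_integral (hM : M.IsAdmissible μ P a b X) (i : Fin n) {z : ℝ}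
    (hz : z ∈ Icc a b) : M.interimUtil μ P i z z = ∫ t in a..z, M.interimAlloc μ P i t := by
  rw [(hM.isSubgradientOn i).integral_eq_sub hz, hM.lowest_type, sub_zero]

theorem interimPay_nonneg (hM : M.IsAdmissible μ P a b X) (i : Fin n) (z : ℝ) :
    0 ≤ M.interimPay μ P i z :=
  integral_nonneg fun _ => hM.pay_nonneg _ _ _

variable [IsProbabilityMeasure μ] [IsProbabilityMeasure P]

theorem interimPay_le (hM : M.IsAdmissible μ P a b X) (hX : X ⊆ Icc 0 c) (ha : 0 ≤ a) (i : Fin n)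
    {z : ℝ} (hz : z ∈ Icc a b) : M.interimPay μ P i z ≤ b * c i := by
  have hx := (hM.hasBoundedAlloc hX).interimAlloc_mem_Icc (μ := μ) (P := P) i z
  calc M.interimPay μ P i z
      ≤ z * M.interimAlloc μ P i z := sub_nonneg.1 (hM.individually_rational i z hz)
    _ ≤ b * c i := mul_le_mul hz.2 hx.2 hx.1 (ha.trans (hz.1.trans hz.2))

theorem integrable_pay_jointLaw (h : IsValuationLaw μ f a b) (hM : M.IsAdmissible μ P a b X)
    (hX : X ⊆ Icc 0 c) (ha : 0 ≤ a) (i : Fin n) :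
    Integrable (fun q : (Fin n → ℝ) × Ω => M.pay q.1 q.2 i) (jointLaw n μ P) := by
  have hmp := measurePreserving_update_jointLaw (μ := μ) (P := P) i
  rw [← hmp.integrable_comp (hM.measurable_pay i).aestronglyMeasurable,
    integrable_prod_iff ((hM.measurable_pay i).comp hmp.measurable).aestronglyMeasurable]
  refine ⟨h.ae_mem_Icc.mono fun z hz => hM.integrable_pay i z hz, ?_⟩
  simp only [Function.comp_apply, Real.norm_of_nonneg (hM.pay_nonneg _ _ _)]
  refine .of_bound (measurable_integral_update i (hM.measurable_pay i)).aestronglyMeasurable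
    (b * c i) (h.ae_mem_Icc.mono fun z hz => ?_)
  exact (Real.norm_of_nonneg (hM.interimPay_nonneg i z)).trans_le (hM.interimPay_le hX ha i hz)

theorem residualSurplus_eq_sum_integral_virtualVal (h : IsValuationLaw μ f a b)
    (hM : M.IsAdmissible μ P a b X) (hX : X ⊆ Icc 0 c) (ha : 0 ≤ a) :
    M.residualSurplus μ P = ∑ i, ∫ z, virtualVal μ f z * M.interimAlloc μ P i z ∂μ := by
  have hA := hM.hasBoundedAlloc hX
  have hid : Integrable id μ :=
    .of_mem_Icc a b measurable_id.aemeasurable h.ae_mem_Icc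
  have hint (i : Fin n) : Integrable (fun q : (Fin n → ℝ) × Ω =>
      q.1 i * M.alloc q.1 q.2 i - M.pay q.1 q.2 i) (jointLaw n μ P) :=
    (hA.integrable_mul_alloc hid i).sub (integrable_pay_jointLaw h hM hX ha i)
  rw [residualSurplus, integral_finsetSum _ fun i _ => hint i]
  refine Finset.sum_congr rfl fun i _ => ?_
  calc ∫ q, (q.1 i * M.alloc q.1 q.2 i - M.pay q.1 q.2 i) ∂jointLaw n μ P
      = ∫ z, M.interimUtil μ P i z z ∂μ := by
        rw [integral_jointLaw_eq_integral_integral_update i (hint i)]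
        refine integral_congr_ae (h.ae_mem_Icc.mono fun z hz => ?_)
        simp only [Function.update_self]
        rw [integral_sub ((hA.integrable_alloc_update i z).const_mul z)
          (hM.integrable_pay i z hz), integral_const_mul, interimUtil, interimAlloc, interimPay]
    _ = ∫ z, (∫ t in a..z, M.interimAlloc μ P i t) ∂μ :=
        integral_congr_ae (h.ae_mem_Icc.mono fun z hz => hM.interimUtil_eq_integral i hz)
    _ = ∫ z, virtualVal μ f z * M.interimAlloc μ P i z ∂μ :=
        h.integral_primitive
          ((hM.isSubgradientOn i).monotoneOn.integrableOn_isCompact isCompact_Icc)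

theorem residualSurplus_eq_ironedSurplus_sub (h : IsValuationLaw μ f a b)
    (hM : M.IsAdmissible μ P a b X) (hX : X ⊆ Icc 0 c) (ha : 0 ≤ a) :
    M.residualSurplus μ P =
      M.ironedSurplus μ f a b P - ∑ i, ironingLoss μ f a b (M.interimAlloc μ P i) := by
  have hA := hM.hasBoundedAlloc hX
  rw [residualSurplus_eq_sum_integral_virtualVal h hM hX ha, ironedSurplus,
    integral_finsetSum _ fun i _ => hA.integrable_mul_alloc h.integrable_ironedVal i,
    ← Finset.sum_sub_distrib]
  refine Finset.sum_congr rfl fun i _ => ?_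
  rw [hA.integral_mul_alloc h.integrable_ironedVal, ironingLoss, ← integral_sub
    (hA.integrable_mul_interimAlloc h.integrable_ironedVal i)
    (hA.integrable_mul_interimAlloc h.integrable_ironedVal_sub_virtualVal i)]
  simp only [sub_mul, sub_sub_cancel]

end IsAdmissible

end Mechanism

/-! ### Mechanisms with envelope payments -/

namespace Mechanism

variable {n : ℕ} {Ω : Type*} [MeasurableSpace Ω]

/-- The mechanism with the allocation rule of `M` in which every agent makes, as a function of its
own report only, the payment given by the envelope formula. The truncation at `0` is only active
for reports outside the type space. -/
def withEnvelopePay (M : Mechanism n Ω) (μ : Measure ℝ) (P : Measure Ω) (a : ℝ) :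
    Mechanism n Ω where
  alloc := M.alloc
  pay v _ i := max 0 (v i * M.interimAlloc μ P i (v i) - ∫ t in a..v i, M.interimAlloc μ P i t)

variable {μ : Measure ℝ} {P : Measure Ω} {a b : ℝ} {X : Set (Fin n → ℝ)} {M : Mechanism n Ω}
  {c : Fin n → ℝ} [IsProbabilityMeasure μ] [IsProbabilityMeasure P]

namespace HasBoundedAlloc

theorem withEnvelopePay_pay_update (hM : M.HasBoundedAlloc c) (ha : 0 ≤ a) {i : Fin n}
    (hmono : MonotoneOn (M.interimAlloc μ P i) (Icc a b)) {z : ℝ} (hz : z ∈ Icc a b)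
    (v : Fin n → ℝ) (ω : Ω) :
    (M.withEnvelopePay μ P a).pay (Function.update v i z) ω i =
      z * M.interimAlloc μ P i z - ∫ t in a..z, M.interimAlloc μ P i t := by
  simp only [withEnvelopePay, Function.update_self]
  have hsub := isSubgradientOn_integral hmono z hz a (left_mem_Icc.2 (hz.1.trans hz.2))
  simp only [intervalIntegral.integral_same] at hsub
  have hax := mul_nonneg ha (hM.interimAlloc_mem_Icc (μ := μ) (P := P) i z).1
  exact max_eq_right (by linarith)

theorem interimUtil_withEnvelopePay (hM : M.HasBoundedAlloc c) (ha : 0 ≤ a) {i : Fin n}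
    (hmono : MonotoneOn (M.interimAlloc μ P i) (Icc a b)) {z' : ℝ} (hz' : z' ∈ Icc a b) (z : ℝ) :
    (M.withEnvelopePay μ P a).interimUtil μ P i z z' =
      (∫ t in a..z', M.interimAlloc μ P i t) + (z - z') * M.interimAlloc μ P i z' := by
  have hpay : (M.withEnvelopePay μ P a).interimPay μ P i z' =
      z' * M.interimAlloc μ P i z' - ∫ t in a..z', M.interimAlloc μ P i t := by
    simp only [interimPay, hM.withEnvelopePay_pay_update ha hmono hz', integral_const,
      probReal_univ, one_smul]
  rw [interimUtil, hpay,
    show (M.withEnvelopePay μ P a).interimAlloc μ P i z' = M.interimAlloc μ P i z' from rfl]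
  ring

theorem measurable_withEnvelopePay_pay (hM : M.HasBoundedAlloc c) (i : Fin n) :
    Measurable fun q : (Fin n → ℝ) × Ω => (M.withEnvelopePay μ P a).pay q.1 q.2 i := by
  have hx : Measurable (M.interimAlloc μ P i) := hM.measurable_interimAlloc i
  have hint (y z : ℝ) : IntervalIntegrable (M.interimAlloc μ P i) volume y z := by
    refine (intervalIntegrable_const (c := c i)).mono_fun hx.aestronglyMeasurable
      (ae_of_all _ fun t => ?_)
    exact abs_le_abs_of_nonneg (hM.interimAlloc_mem_Icc i t).1 (hM.interimAlloc_mem_Icc i t).2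
  have hprim : Measurable fun z => ∫ t in a..z, M.interimAlloc μ P i t :=
    (intervalIntegral.continuous_primitive hint a).measurable
  have hreport : Measurable fun q : (Fin n → ℝ) × Ω => q.1 i := by fun_prop
  exact measurable_const.max ((hreport.mul (hx.comp hreport)).sub (hprim.comp hreport))

theorem isAdmissible_withEnvelopePay (hM : M.HasBoundedAlloc c) (ha : 0 ≤ a) (hab : a ≤ b)
    (hfeas : ∀ v ω, M.alloc v ω ∈ X) (hmono : ∀ i, MonotoneOn (M.interimAlloc μ P i) (Icc a b)) :
    (M.withEnvelopePay μ P a).IsAdmissible μ P a b X where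
  measurable_alloc := hM.measurable_alloc
  measurable_pay := hM.measurable_withEnvelopePay_pay
  feasible := hfeas
  pay_nonneg _ _ _ := le_max_left _ _
  integrable_pay i z hz := by
    simp only [hM.withEnvelopePay_pay_update ha (hmono i) hz]
    exact integrable_const _
  incentive_compatible i z hz z' hz' := by
    rw [hM.interimUtil_withEnvelopePay ha (hmono i) hz',
      hM.interimUtil_withEnvelopePay ha (hmono i) hz, sub_self, zero_mul, add_zero]
    exact isSubgradientOn_integral (hmono i) z' hz' z hz
  individually_rational i z hz := by
    rw [hM.interimUtil_withEnvelopePay ha (hmono i) hz, sub_self, zero_mul, add_zero]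
    exact intervalIntegral.integral_nonneg hz.1 fun t _ => (hM.interimAlloc_mem_Icc i t).1
  lowest_type i := by
    rw [hM.interimUtil_withEnvelopePay ha (hmono i) (left_mem_Icc.2 hab), sub_self, zero_mul,
      add_zero, intervalIntegral.integral_same]

end HasBoundedAlloc

end Mechanism

/-! ### Maximizing the ironed virtual surplus pointwise -/

theorem exists_measurable_isMaxOn {W β : Type*} [MeasurableSpace W] [MeasurableSpace β] {X : Set β}
    (hX : X.Finite) (hne : X.Nonempty) {φ : W → β → ℝ} (hφ : Measurable (Function.uncurry φ)) :
    ∃ S : W → β, Measurable S ∧ ∀ w, S w ∈ X ∧ IsMaxOn (φ w) X (S w) := by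
  induction X, hX using Set.Finite.induction_on with
  | empty => exact absurd hne not_nonempty_empty
  | @insert x X _ _ ih =>
    rcases X.eq_empty_or_nonempty with rfl | hX
    · refine ⟨fun _ => x, measurable_const, fun w => ⟨mem_insert x ∅, ?_⟩⟩
      simp [isMaxOn_iff]
    obtain ⟨S, hS, hmax⟩ := ih hX
    classical
    refine ⟨fun w => if φ w (S w) ≤ φ w x then x else S w, .ite (measurableSet_le
      (hφ.comp (measurable_id.prodMk hS)) (hφ.comp measurable_prodMk_right)) measurable_const hS,
      fun w => ?_⟩
    obtain ⟨hSX, hSmax⟩ := hmax w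
    dsimp only
    split_ifs with hle
    · refine ⟨mem_insert x X, isMaxOn_iff.2 ?_⟩
      rintro y (rfl | hy)
      exacts [le_rfl, (hSmax hy).trans hle]
    · refine ⟨mem_insert_of_mem x hSX, isMaxOn_iff.2 ?_⟩
      rintro y (rfl | hy)
      exacts [(not_le.1 hle).le, hSmax hy]

section Exchange

open scoped Matrix

variable {ι : Type*} [Fintype ι] [DecidableEq ι] {X : Set (ι → ℝ)} {x y w : ι → ℝ} {i : ι} {t : ℝ}

theorem apply_le_of_isMaxOn_update (hx : x ∈ X) (hy : y ∈ X) (hxmax : IsMaxOn (w ⬝ᵥ ·) X x)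
    (hymax : IsMaxOn (Function.update w i t ⬝ᵥ ·) X y) (ht : w i < t) : x i ≤ y i := by
  have hupdate (u : ι → ℝ) : Function.update w i t ⬝ᵥ u = w ⬝ᵥ u + (t - w i) * u i := by
    rw [← single_dotProduct, ← add_dotProduct]
    congr 1
    ext j
    by_cases hj : j = i
    · subst hj; simp
    · simp [hj]
  have hxy : w ⬝ᵥ y ≤ w ⬝ᵥ x := hxmax hy
  have hyx : Function.update w i t ⬝ᵥ x ≤ Function.update w i t ⬝ᵥ y := hymax hx
  rw [hupdate, hupdate] at hyx
  exact le_of_mul_le_mul_left (by linarith) (sub_pos.2 ht)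

theorem apply_le_of_isMaxOn_single (hx : x ∈ X) (hymax : IsMaxOn (Pi.single i 1 ⬝ᵥ ·) X y) :
    x i ≤ y i := by
  have hxy : Pi.single i 1 ⬝ᵥ x ≤ Pi.single i 1 ⬝ᵥ y := hymax hx
  simpa only [single_one_dotProduct] using hxy

end Exchange

open scoped Classical in
/-- The weights with which an allocation is chosen at the profile `v`. Below `b` they are the ironed
virtual valuations. Since these may be unbounded near `b`, a report of at least `b` overrides all
smaller ones; this keeps the allocation monotone up to the highest type. -/
def ironedWeight {n : ℕ} (μ : Measure ℝ) (f : ℝ → ℝ) (a b : ℝ) (v : Fin n → ℝ) : Fin n → ℝ :=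
  if ∀ j, v j < b then fun j => ironedVal μ f a b (v j)
  else fun j => if v j < b then 0 else 1

section IronedWeight

variable {n : ℕ} {μ : Measure ℝ} {f : ℝ → ℝ} {a b : ℝ} {v : Fin n → ℝ} {i : Fin n}

theorem ironedWeight_of_lt (hv : ∀ j, v j < b) :
    ironedWeight μ f a b v = fun j => ironedVal μ f a b (v j) :=
  if_pos hv

theorem ironedWeight_update_of_lt (hv : ∀ j, v j < b) {z : ℝ} (hz : z < b) :
    ironedWeight μ f a b (Function.update v i z) =
      Function.update (fun j => ironedVal μ f a b (v j)) i (ironedVal μ f a b z) := by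
  rw [ironedWeight_of_lt ((Function.forall_update_iff v fun _ t => t < b).2 ⟨hz, fun j _ => hv j⟩)]
  ext j
  exact Function.apply_update (fun _ => ironedVal μ f a b) v i z j

theorem ironedWeight_update_right (hv : ∀ j, v j < b) :
    ironedWeight μ f a b (Function.update v i b) = Pi.single i 1 := by
  rw [ironedWeight, if_neg fun hlt => (hlt i).ne (Function.update_self i b v)]
  ext j
  by_cases hj : j = i
  · subst hj; simp
  · simp [hj, hv j]

theorem measurable_ironedWeight (n : ℕ) (μ : Measure ℝ) (f : ℝ → ℝ) (a b : ℝ) :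
    Measurable (ironedWeight (n := n) μ f a b) := by
  have hlt : MeasurableSet {v : Fin n → ℝ | ∀ j, v j < b} := by
    simp only [ofPred_forall]
    exact .iInter fun j => measurableSet_lt (measurable_pi_apply j) measurable_const
  refine .ite hlt ?_ ?_ <;> refine measurable_pi_iff.2 fun j => ?_
  · exact (measurable_ironedVal μ f a b).comp (measurable_pi_apply j)
  · exact .ite (measurableSet_lt (measurable_pi_apply j) measurable_const) measurable_const
      measurable_const

end IronedWeight

section Selection

open scoped Matrix

variable {n : ℕ} {μ : Measure ℝ} {f : ℝ → ℝ} {a b : ℝ} {v : Fin n → ℝ} {X : Set (Fin n → ℝ)}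
  {S : (Fin n → ℝ) → Fin n → ℝ} [IsProbabilityMeasure μ]

theorem IsValuationLaw.monotoneOn_selection_ironedWeight (h : IsValuationLaw μ f a b)
    (hS : ∀ w, S w ∈ X ∧ IsMaxOn (w ⬝ᵥ ·) X (S w)) (hv : ∀ j, v j < b) (i : Fin n) :
    MonotoneOn (fun z => S (ironedWeight μ f a b (Function.update v i z)) i) (Icc a b) := by
  intro z hz z' hz' hle
  dsimp only
  rcases hz'.2.eq_or_lt with hz'b | hz'b
  · rw [hz'b, ironedWeight_update_right hv]
    exact apply_le_of_isMaxOn_single (hS _).1 (hS _).2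
  · have hzb := hle.trans_lt hz'b
    rw [ironedWeight_update_of_lt hv hzb, ironedWeight_update_of_lt hv hz'b]
    rcases (h.monotoneOn_ironedVal ⟨hz.1, hzb⟩ ⟨hz'.1, hz'b⟩ hle).eq_or_lt with heq | hlt
    · rw [heq]
    · refine apply_le_of_isMaxOn_update (t := ironedVal μ f a b z') (hS _).1 (hS _).1 (hS _).2 ?_
        (by rwa [Function.update_self])
      rw [Function.update_idem]
      exact (hS _).2

theorem IsValuationLaw.eventually_ironedWeight_update_eq (h : IsValuationLaw μ f a b) {z : ℝ}
    (hz : z ∈ ironedSet μ f a b) (i : Fin n) :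
    ∀ᶠ z' in 𝓝 z, ∀ v : Fin n → ℝ, (∀ j, v j < b) →
      ironedWeight μ f a b (Function.update v i z') =
        ironedWeight μ f a b (Function.update v i z) := by
  have hzb := (h.ironedSet_subset_Ioo hz).2
  filter_upwards [h.eventually_ironedVal_eq hz, eventually_lt_nhds hzb] with z' heq hz'b v hv
  rw [ironedWeight_update_of_lt hv hz'b, ironedWeight_update_of_lt hv hzb, heq]

end Selection

namespace Mechanism

variable {n : ℕ} {Ω : Type*} [MeasurableSpace Ω]

/-- Almost surely, the allocation maximizes the ironed virtual surplus over `X`. -/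
def MaximizesIronedSurplus (M : Mechanism n Ω) (μ : Measure ℝ) (f : ℝ → ℝ) (a b : ℝ)
    (P : Measure Ω) (X : Set (Fin n → ℝ)) : Prop :=
  ∀ᵐ q ∂jointLaw n μ P, ∀ y ∈ X, ∑ i, ironedVal μ f a b (q.1 i) * y i ≤
    ∑ i, ironedVal μ f a b (q.1 i) * M.alloc q.1 q.2 i

/-- The deterministic allocation rule that applies the selection `S` to the ironed weights of the
reports. Incentive compatible payments are supplied by `withEnvelopePay`. -/
def ofSelection (S : (Fin n → ℝ) → Fin n → ℝ) (μ : Measure ℝ) (f : ℝ → ℝ) (a b : ℝ) :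
    Mechanism n Ω where
  alloc v _ := S (ironedWeight μ f a b v)
  pay := 0

section OfSelection

open scoped Matrix

variable {μ : Measure ℝ} {P : Measure Ω} {f : ℝ → ℝ} {a b : ℝ} {X : Set (Fin n → ℝ)}
  {c : Fin n → ℝ} {S : (Fin n → ℝ) → Fin n → ℝ}

theorem hasBoundedAlloc_ofSelection (hS : Measurable S) (hSc : ∀ w, S w ∈ Icc 0 c) :
    (ofSelection S μ f a b : Mechanism n Ω).HasBoundedAlloc c where
  measurable_alloc := measurable_pi_iff.1 <|
    hS.comp ((measurable_ironedWeight n μ f a b).comp measurable_fst)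
  alloc_mem_Icc _ _ := hSc _

variable [IsProbabilityMeasure μ] [IsProbabilityMeasure P]

theorem maximizesIronedSurplus_ofSelection (h : IsValuationLaw μ f a b)
    (hS : ∀ w, IsMaxOn (w ⬝ᵥ ·) X (S w)) :
    (ofSelection S μ f a b : Mechanism n Ω).MaximizesIronedSurplus μ f a b P X := by
  filter_upwards [ae_jointLaw_of_ae h.ae_mem_Ioo] with q hq y hy
  have hmax : ironedWeight μ f a b q.1 ⬝ᵥ y ≤
      ironedWeight μ f a b q.1 ⬝ᵥ S (ironedWeight μ f a b q.1) := hS _ hy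
  simpa only [ofSelection, dotProduct, ironedWeight_of_lt fun j => (hq j).2] using hmax

theorem monotoneOn_interimAlloc_ofSelection (h : IsValuationLaw μ f a b) (hSm : Measurable S)
    (hSc : ∀ w, S w ∈ Icc 0 c) (hS : ∀ w, S w ∈ X ∧ IsMaxOn (w ⬝ᵥ ·) X (S w)) (i : Fin n) :
    MonotoneOn ((ofSelection S μ f a b : Mechanism n Ω).interimAlloc μ P i) (Icc a b) := by
  have hA : (ofSelection S μ f a b : Mechanism n Ω).HasBoundedAlloc c :=
    hasBoundedAlloc_ofSelection hSm hSc
  intro z hz z' hz' hle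
  refine integral_mono_ae (hA.integrable_alloc_update i z) (hA.integrable_alloc_update i z') ?_
  filter_upwards [ae_jointLaw_of_ae h.ae_mem_Ioo] with q hq
  exact h.monotoneOn_selection_ironedWeight hS (fun j => (hq j).2) i hz hz' hle

theorem hasDerivAt_interimAlloc_ofSelection (h : IsValuationLaw μ f a b) (i : Fin n) {z : ℝ}
    (hz : z ∈ ironedSet μ f a b) :
    HasDerivAt ((ofSelection S μ f a b : Mechanism n Ω).interimAlloc μ P i) 0 z := by
  refine (hasDerivAt_const z ((ofSelection S μ f a b : Mechanism n Ω).interimAlloc μ P i z)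
    ).congr_of_eventuallyEq ?_
  filter_upwards [h.eventually_ironedWeight_update_eq hz i] with z' hz'
  refine integral_congr_ae ?_
  filter_upwards [ae_jointLaw_of_ae h.ae_mem_Ioo] with q hq
  exact congrArg (S · i) (hz' q.1 fun j => (hq j).2)

end OfSelection

/-! ### Optimal mechanisms -/

variable {μ : Measure ℝ} {P : Measure Ω} {f : ℝ → ℝ} {a b : ℝ} {X : Set (Fin n → ℝ)}
  {c : Fin n → ℝ} {M M' : Mechanism n Ω} [IsProbabilityMeasure μ] [IsProbabilityMeasure P]

namespace IsAdmissible

theorem ironingLoss_nonneg (h : IsValuationLaw μ f a b) (hM : M.IsAdmissible μ P a b X)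
    (hX : X ⊆ Icc 0 c) (i : Fin n) : 0 ≤ ironingLoss μ f a b (M.interimAlloc μ P i) :=
  h.ironingLoss_nonneg ((hM.hasBoundedAlloc hX).measurable_interimAlloc i)
    (hM.isSubgradientOn i).monotoneOn ((hM.hasBoundedAlloc hX).interimAlloc_mem_Icc i)

theorem ironingLoss_eq_zero_iff (h : IsValuationLaw μ f a b) (hM : M.IsAdmissible μ P a b X)
    (hX : X ⊆ Icc 0 c) (i : Fin n) : ironingLoss μ f a b (M.interimAlloc μ P i) = 0 ↔
      ∀ z ∈ ironedSet μ f a b, HasDerivAt (M.interimAlloc μ P i) 0 z :=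
  h.ironingLoss_eq_zero_iff ((hM.hasBoundedAlloc hX).measurable_interimAlloc i)
    (hM.isSubgradientOn i).monotoneOn ((hM.hasBoundedAlloc hX).interimAlloc_mem_Icc i)

end IsAdmissible

theorem exists_isAdmissible_maximizesIronedSurplus (h : IsValuationLaw μ f a b) (ha : 0 ≤ a)
    (hfin : X.Finite) (hne : X.Nonempty) (hX : X ⊆ Icc 0 c) :
    ∃ M : Mechanism n Ω, M.IsAdmissible μ P a b X ∧ M.MaximizesIronedSurplus μ f a b P X ∧
      ∀ i, ironingLoss μ f a b (M.interimAlloc μ P i) = 0 := by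
  obtain ⟨S, hSm, hS⟩ := exists_measurable_isMaxOn hfin hne (φ := fun w x => w ⬝ᵥ x) <| by
    simp only [Function.uncurry_def, dotProduct]
    fun_prop
  have hSc (w : Fin n → ℝ) : S w ∈ Icc 0 c := hX (hS w).1
  have hadm := (hasBoundedAlloc_ofSelection (Ω := Ω) (μ := μ) (f := f) hSm
    hSc).isAdmissible_withEnvelopePay (P := P) ha h.lt.le (fun _ _ => (hS _).1)
    (monotoneOn_interimAlloc_ofSelection h hSm hSc hS)
  exact ⟨_, hadm, maximizesIronedSurplus_ofSelection h fun w => (hS w).2, fun i =>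
    (hadm.ironingLoss_eq_zero_iff h hX i).2 fun z hz => hasDerivAt_interimAlloc_ofSelection h i hz⟩

theorem HasBoundedAlloc.integrable_sum_ironedVal_mul_alloc (h : IsValuationLaw μ f a b)
    (hM : M.HasBoundedAlloc c) :
    Integrable (fun q : (Fin n → ℝ) × Ω => ∑ i, ironedVal μ f a b (q.1 i) * M.alloc q.1 q.2 i)
      (jointLaw n μ P) :=
  integrable_finsetSum _ fun i _ => hM.integrable_mul_alloc h.integrable_ironedVal i

namespace MaximizesIronedSurplus

theorem ironedSurplus_le (h : IsValuationLaw μ f a b) (hX : X ⊆ Icc 0 c)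
    (hM : M.IsAdmissible μ P a b X) (hM' : M'.IsAdmissible μ P a b X)
    (hmax : M.MaximizesIronedSurplus μ f a b P X) :
    M'.ironedSurplus μ f a b P ≤ M.ironedSurplus μ f a b P :=
  integral_mono_ae ((hM'.hasBoundedAlloc hX).integrable_sum_ironedVal_mul_alloc h)
    ((hM.hasBoundedAlloc hX).integrable_sum_ironedVal_mul_alloc h)
    (hmax.mono fun q hq => hq _ (hM'.feasible q.1 q.2))

theorem of_ironedSurplus_le (h : IsValuationLaw μ f a b) (hX : X ⊆ Icc 0 c)
    (hM : M.IsAdmissible μ P a b X) (hM' : M'.IsAdmissible μ P a b X)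
    (hmax : M.MaximizesIronedSurplus μ f a b P X)
    (hle : M.ironedSurplus μ f a b P ≤ M'.ironedSurplus μ f a b P) :
    M'.MaximizesIronedSurplus μ f a b P X := by
  have heq := (integral_eq_iff_of_ae_le
    ((hM'.hasBoundedAlloc hX).integrable_sum_ironedVal_mul_alloc h)
    ((hM.hasBoundedAlloc hX).integrable_sum_ironedVal_mul_alloc h)
    (hmax.mono fun q hq => hq _ (hM'.feasible q.1 q.2))).1
    ((hmax.ironedSurplus_le h hX hM hM').antisymm hle)
  filter_upwards [heq, hmax] with q hq hqmax y hy
  exact (hqmax y hy).trans_eq hq.symm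

end MaximizesIronedSurplus

theorem isOptimal_iff (h : IsValuationLaw μ f a b) (ha : 0 ≤ a) (hfin : X.Finite)
    (hX : X ⊆ Icc 0 c) :
    M.IsOptimal μ P a b X ↔ M.IsAdmissible μ P a b X ∧ M.MaximizesIronedSurplus μ f a b P X ∧
      ∀ i, ironingLoss μ f a b (M.interimAlloc μ P i) = 0 := by
  refine and_congr_right fun hM => ⟨fun hopt => ?_, fun ⟨hmax, hloss⟩ M' hM' => ?_⟩
  · obtain ⟨v, ω⟩ : Nonempty ((Fin n → ℝ) × Ω) := nonempty_of_isProbabilityMeasure (jointLaw n μ P)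
    obtain ⟨M', hM', hmax', hloss'⟩ :=
      exists_isAdmissible_maximizesIronedSurplus (P := P) h ha hfin ⟨_, hM.feasible v ω⟩ hX
    have hle := hopt M' hM'
    rw [hM.residualSurplus_eq_ironedSurplus_sub h hX ha,
      hM'.residualSurplus_eq_ironedSurplus_sub h hX ha,
      Finset.sum_eq_zero fun i _ => hloss' i, sub_zero] at hle
    have hnonneg (i : Fin n) (_ : i ∈ Finset.univ) := hM.ironingLoss_nonneg h hX i
    have hsum := Finset.sum_nonneg hnonneg
    have hsurplus := hmax'.ironedSurplus_le h hX hM' hM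
    refine ⟨hmax'.of_ironedSurplus_le h hX hM' hM (by linarith), fun i => ?_⟩
    exact (Finset.sum_eq_zero_iff_of_nonneg hnonneg).1 (by linarith) i (Finset.mem_univ i)
  · rw [hM.residualSurplus_eq_ironedSurplus_sub h hX ha,
      hM'.residualSurplus_eq_ironedSurplus_sub h hX ha]
    exact sub_le_sub (hmax.ironedSurplus_le h hX hM hM') <|
      Finset.sum_le_sum fun i _ => (hloss i).trans_le (hM'.ironingLoss_nonneg h hX i)

end Mechanism

end MoneyBurning

end

open MeasureTheory MoneyBurning Mechanism in
theorem theoremt_general {n : ℕ} {Ω : Type*} [MeasurableSpace Ω]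
    (P : Measure Ω) [IsProbabilityMeasure P] (a b : ℝ) (ha : 0 ≤ a) (hab : a < b)
    (f : ℝ → ℝ) (hf : Measurable f) (hpos : ∀ z ∈ Set.Icc a b, 0 < f z)
    (μ : Measure ℝ) [IsProbabilityMeasure μ]
    (hμ : μ = (volume.restrict (Set.Icc a b)).withDensity fun z => ENNReal.ofReal (f z))
    (X : Set (Fin n → ℝ)) (hfin : X.Finite) (hX : ∀ x ∈ X, 0 ≤ x) (M : Mechanism n Ω) :
    M.IsOptimal μ P a b X ↔
      M.IsAdmissible μ P a b X ∧
      (∀ᵐ q ∂jointLaw n μ P, M.alloc q.1 q.2 ∈ X ∧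
        ∀ y ∈ X, ∑ i, ironedVal μ f a b (q.1 i) * y i ≤
          ∑ i, ironedVal μ f a b (q.1 i) * M.alloc q.1 q.2 i) ∧
      (∀ i, ∀ z ∈ Set.Icc a b,
        GFun μ f a b (ProbabilityTheory.cdf μ z) < HFun μ f a b (ProbabilityTheory.cdf μ z) →
          HasDerivAt (M.interimAlloc μ P i) 0 z) := by
  have h : IsValuationLaw μ f a b := ⟨hab, hf, hpos, hμ⟩
  obtain ⟨c, hc⟩ := hfin.bddAbove
  have hXc : X ⊆ Set.Icc 0 c := fun x hx => ⟨hX x hx, hc hx⟩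
  rw [isOptimal_iff h ha hfin hXc]
  refine and_congr_right fun hM => and_congr ?_ (forall_congr' fun i => ?_)
  · simp only [MaximizesIronedSurplus, hM.feasible, true_and]
  · exact (hM.ironingLoss_eq_zero_iff h hXc i).trans
      ⟨fun hder z _ hlt => hder z (sub_pos.2 hlt), fun hder z hz =>
        hder z (Set.Ioo_subset_Icc_self (h.ironedSet_subset_Ioo hz)) (sub_pos.1 hz)⟩

theorem theoremt {n : ℕ} {Ω : Type*} [MeasurableSpace Ω]
    (P : MeasureTheory.Measure Ω) [MeasureTheory.IsProbabilityMeasure P]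
    (a b : ℝ) (ha : 0 ≤ a) (hab : a < b)
    (f : ℝ → ℝ) (hf : Measurable f) (hpos : ∀ z ∈ Set.Icc a b, 0 < f z)
    (μ : MeasureTheory.Measure ℝ) [MeasureTheory.IsProbabilityMeasure μ]
    (hμ : μ = (MeasureTheory.volume.restrict (Set.Icc a b)).withDensity
      (fun z => ENNReal.ofReal (f z)))
    (X : Set (Fin n → ℝ)) (hX : ∀ x ∈ X, ∀ i, x i = 0 ∨ x i = 1)
    (M : MoneyBurning.Mechanism n Ω) :
    M.IsOptimal μ P a b X ↔
      M.IsAdmissible μ P a b X ∧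
      (∀ᵐ q ∂(MoneyBurning.Mechanism.jointLaw n μ P),
        M.alloc q.1 q.2 ∈ X ∧
        ∀ y ∈ X, ∑ i, MoneyBurning.ironedVal μ f a b (q.1 i) * y i ≤
          ∑ i, MoneyBurning.ironedVal μ f a b (q.1 i) * M.alloc q.1 q.2 i) ∧
      (∀ i, ∀ z ∈ Set.Icc a b,
        MoneyBurning.GFun μ f a b (ProbabilityTheory.cdf μ z) <
            MoneyBurning.HFun μ f a b (ProbabilityTheory.cdf μ z) →
          HasDerivAt (M.interimAlloc μ P i) 0 z) :=
  theoremt_general P a b ha hab f hf hpos μ hμ X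
    ((Set.Finite.pi' fun _ => Set.toFinite {0, 1}).subset hX)
    (fun x hx i => (hX x hx i).elim (fun h => h.ge) fun h => zero_le_one.trans h.ge) M
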